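/- **Setting.** Let $k$ be the security parameter. "Polynomial time" means non-uniform polynomial time (Boolean circuits of size polynomial in $k$; probabilistic algorithms receive uniform coins), for the parties, the simulators, the distinguishers and the adversaries. A *conventional $1$-out-of-$n$ OT* consists of algorithms $\mathtt{S.Init}(1^k)\to pk$, $\mathtt{R.GenQuery}(pk,n,s)\to(q,sp)$, $\mathtt{S.GenRes}(m_0,\dots,m_{n-1},pk,q)\to res=[e_0,\dots,e_{n-1}]$ and a deterministic $\mathtt{R.Retrieve}$. The messages have a common length depending only on $k$; each $e_i$ consists of $w$ values of $\ell\ge 1$ bits, where $w=w(k)$ and $\ell=\ell(k)$ do not depend on $n$; and the receiver obtains its output as $\mathtt{R.Retrieve}(e_s,q,sp,pk,s)$, i.e. from the component $e_s$. The sender sends $pk$, the receiver sends $q$, the sender sends $res$. An *additively homomorphic encryption scheme* $(\mathtt{KGen},\mathtt{Enc},\mathtt{Dec},+_H,\times_H)$ consists of polynomial-time algorithms; its plaintexts are the $\ell$-bit strings, which stand for elements of a commutative ring attached to the key pair, two of them standing for $0$ and $1$. Ciphertexts are strings whose length depends only on $k$. The operation $+_H$ takes encryptions of $x,y$ to an encryption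 of $x+y$, and $\times_H$ takes an encryption of $x$ and a plaintext $c$ to an encryption of $x\cdot c$, where every ciphertext that is obtained from fresh encryptions by such operations and encrypts a plaintext $x$ is decrypted to $x$. The *compiled protocol*: the sender publishes $pk\leftarrow \mathtt{S.Init}(1^k)$. The receiver generates $(sk_R,pk_R)\leftarrow\mathtt{KGen}(1^k)$ and $(q,sp)\leftarrow\mathtt{R.GenQuery}(pk,n,s)$, and sends $pk_R$, $q$ and $b'_i\leftarrow\mathtt{Enc}(pk_R,b_i)$ for $0\le i\le n-1$, where $b_s=1$ and $b_i=0$ for $i\ne s$. The sender computes $[e_0,\dots,e_{n-1}]\leftarrow \mathtt{S.GenRes}(m_0,\dots,m_{n-1},pk,q)$ with $e_i=(e_{i,1},\dots,e_{i,w})$, and sends, for each $1\le j\le w$, the ciphertext $(b'_0\times_H e_{0,j})+_H\cdots+_H(b'_{n-1}\times_H e_{n-1,j})$. The receiver decrypts these $w$ ciphertexts with $sk_R$ and applies $\mathtt{R.Retrieve}$ to the result, $q$, $sp$, $pk$ and $s$. A protocol *securely computes* $\mathcal F_{OT^n_1}:((m_0,\dots,m_{n-1}),s)\mapsto(\epsilon,m_s)$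 *in the presence of (non-colluding) semi-honest adversaries* if its algorithms run in polynomial time, the receiver outputs $m_s$ except with negligible probability, and there are polynomial-time simulators $\mathsf{Sim}_S$, $\mathsf{Sim}_R$ such that $\mathsf{Sim}_S((m_0,\dots,m_{n-1}),\epsilon)$ is computationally indistinguishable from the sender's view, and $\mathsf{Sim}_R(s,m_s)$ from the receiver's view, in the real execution, where a view consists of the party's input, its coins and the messages it receives and indistinguishability is uniform over all inputs. A conventional OT is *secure* if its protocol securely computes $\mathcal F_{OT^n_1}$. **Theorem.** Let a conventional $1$-out-of-$n$ OT and an additively homomorphic encryption scheme with the same $\ell$ be given, and let the encryption scheme be IND-CPA secure. (i) For every polynomially bounded $n=n(k)\ge 1$: if the conventional OT is secure for $n$ messages, then the compiled protocol securely computes $\mathcal F_{OT^n_1}$ in the presence of semi-honest adversaries. (ii) The response of the compiled protocol consists of $w$ ciphertexts; its bit length is $w(k)$ times the ciphertext length, for every $n$, and thus $O(1)$ with respect to $n$. -/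

import Mathlib

open Filter Asymptotics

namespace ConstOT

/-- Bit strings of length `L`. -/
abbrev Bits (L : ℕ) : Type := Fin L → Bool

/-! ### Boolean circuits and non-uniform polynomial time -/

/-- Boolean circuits, as straight-line programs. The wires available are indexed by `ι`; every gate
adds one wire (`none`) to the available ones, and finally each output position in `κ` reads a wire.
The gates are the constants and NAND. -/
inductive Circuit (κ : Type) : Type → Type 1
  | out {ι : Type} (o : κ → ι) : Circuit κ ι
  | const {ι : Type} (b : Bool) (C : Circuit κ (Option ι)) : Circuit κ ι
  | nand {ι : Type} (i j : ι) (C : Circuit κ (Option ι)) : Circuit κ ι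

/-- The output of a circuit on an assignment of its input wires. -/
def Circuit.eval {κ : Type} : {ι : Type} → Circuit κ ι → (ι → Bool) → κ → Bool
  | _, .out o, x => fun j => x (o j)
  | _, .const b C, x => C.eval (fun i => i.elim b x)
  | _, .nand i j C, x => C.eval (fun l => l.elim (!(x i && x j)) x)

/-- The number of gates of a circuit. -/
def Circuit.size {κ : Type} : {ι : Type} → Circuit κ ι → ℕ
  | _, .out _ => 0
  | _, .const _ C => C.size + 1
  | _, .nand _ _ C => C.size + 1

/-- A representation of the elements of `α` by bit strings of a fixed length (the number of
elements of `Idx`). -/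
class BitRep (α : Type) where
  Idx : Type
  finIdx : Fintype Idx
  bits : α → Idx → Bool
  bits_injective : Function.Injective bits

attribute [reducible, instance] BitRep.finIdx

instance BitRep.instUnit : BitRep Unit where
  Idx := Empty
  finIdx := inferInstance
  bits _ := Empty.elim
  bits_injective := fun _ _ _ => rfl

instance BitRep.instBool : BitRep Bool where
  Idx := Unit
  finIdx := inferInstance
  bits b _ := b
  bits_injective := fun _ _ h => congrFun h ()

/-- An index in `{0, …, n-1}` is represented by its indicator string of length `n`. (For `n`
polynomially bounded, small circuits convert this to and from binary notation.) -/
instance BitRep.instFin (n : ℕ) : BitRep (Fin n) where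
  Idx := Fin n
  finIdx := inferInstance
  bits s i := decide (i = s)
  bits_injective := fun s t h => by simpa using congrFun h s

instance BitRep.instProd (α β : Type) [BitRep α] [BitRep β] : BitRep (α × β) where
  Idx := BitRep.Idx α ⊕ BitRep.Idx β
  finIdx := inferInstance
  bits x := Sum.elim (BitRep.bits x.1) (BitRep.bits x.2)
  bits_injective := fun _ _ h => Prod.ext
    (BitRep.bits_injective (funext fun i => congrFun h (Sum.inl i)))
    (BitRep.bits_injective (funext fun i => congrFun h (Sum.inr i)))

instance BitRep.instPi (ι α : Type) [Fintype ι] [BitRep α] : BitRep (ι → α) where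
  Idx := ι × BitRep.Idx α
  finIdx := inferInstance
  bits x i := BitRep.bits (x i.1) i.2
  bits_injective := fun _ _ h => funext fun i =>
    BitRep.bits_injective (funext fun j => congrFun h (i, j))

/-- The number of bits of an element of `α`. -/
def bitLength (α : Type) [BitRep α] : ℕ := Fintype.card (BitRep.Idx α)

/-- `f` is bounded by a polynomial in the security parameter. -/
def PolyBounded (f : ℕ → ℕ) : Prop := ∃ p : Polynomial ℕ, ∀ k, f k ≤ p.eval k

/-- The family `F`, indexed by the security parameter, is computable in non-uniform polynomial
time: by circuits whose number of inputs, outputs and gates is polynomially bounded. A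
probabilistic algorithm is a family one of whose arguments is a string of uniform coins. -/
def PolyTime {α β : ℕ → Type} [∀ k, BitRep (α k)] [∀ k, BitRep (β k)]
    (F : ∀ k, α k → β k) : Prop :=
  ∃ p : Polynomial ℕ, ∀ k, ∃ C : Circuit (BitRep.Idx (β k)) (BitRep.Idx (α k)),
    bitLength (α k) + bitLength (β k) + C.size ≤ p.eval k ∧
      ∀ x, C.eval (BitRep.bits x) = BitRep.bits (F k x)

/-! ### Probabilities and computational indistinguishability -/

/-- The probability of an event when the (finite) sample space carries the uniform distribution. -/
noncomputable def prob {Ω : Type} (A : Ω → Prop) : ℝ :=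
  (Nat.card {ω : Ω // A ω} : ℝ) / (Nat.card Ω : ℝ)

/-- Negligible functions of the security parameter. -/
def Negligible (μ : ℕ → ℝ) : Prop := SuperpolynomialDecay atTop (fun k : ℕ => (k : ℝ)) μ

/-- Computational indistinguishability of two ensembles indexed by the security parameter `k` and
by an input in `I k`. For fixed `k` and input, an ensemble is a function of uniform coins (in `Ω k`,
respectively `Ω' k`). The distinguishers are non-uniform probabilistic polynomial-time, with
`|c k|` coins, and their advantage is negligible uniformly over the inputs. -/
def CompIndist {I Ω Ω' V : ℕ → Type} [∀ k, BitRep (V k)]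
    (X : ∀ k, I k → Ω k → V k) (Y : ∀ k, I k → Ω' k → V k) : Prop :=
  ∀ (c : ℕ → Type) [∀ k, Fintype (c k)] (D : ∀ k, V k × (c k → Bool) → Bool),
    PolyTime D →
    ∃ μ : ℕ → ℝ, Negligible μ ∧ ∀ k (i : I k),
      |prob (fun ω : Ω k × (c k → Bool) => D k (X k i ω.1, ω.2) = true) -
        prob (fun ω : Ω' k × (c k → Bool) => D k (Y k i ω.1, ω.2) = true)| ≤ μ k

/-! ### Protocols for 1-out-of-`n` oblivious transfer and their security -/

/-- The functionality `((m₀, …, mₙ₋₁), s) ↦ (ε, mₛ)`. -/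
def fOT {n : ℕ} {M : Type} (m : Fin n → M) (s : Fin n) : Unit × M := ((), m s)

/-- Protocols between a sender, who holds messages `m₀, …, mₙ₋₁`, and a receiver, who holds an
index `s`: the sender publishes a public key, the receiver sends a query and keeps a secret
parameter, the sender sends a response, from which the receiver computes its output. All data depend
on the security parameter `k` and on `n`. The coins are bit strings whose positions are indexed
by `InitCoins`, `QueryCoins`, `ResCoins`. -/
structure OTProtocol (msgLen : ℕ → ℕ) where
  InitCoins : ℕ → ℕ → Type
  QueryCoins : ℕ → ℕ → Type
  ResCoins : ℕ → ℕ → Type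
  finInit : ∀ k n, Fintype (InitCoins k n)
  finQuery : ∀ k n, Fintype (QueryCoins k n)
  finRes : ∀ k n, Fintype (ResCoins k n)
  PK : ℕ → ℕ → Type
  Query : ℕ → ℕ → Type
  Secret : ℕ → ℕ → Type
  Res : ℕ → ℕ → Type
  repPK : ∀ k n, BitRep (PK k n)
  repQuery : ∀ k n, BitRep (Query k n)
  repSecret : ∀ k n, BitRep (Secret k n)
  repRes : ∀ k n, BitRep (Res k n)
  init : ∀ k n, (InitCoins k n → Bool) → PK k n
  genQuery : ∀ k n, PK k n → Fin n → (QueryCoins k n → Bool) → Query k n × Secret k n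
  genRes : ∀ k n, (Fin n → Bits (msgLen k)) → PK k n → Query k n →
    (ResCoins k n → Bool) → Res k n
  retrieve : ∀ k n, Res k n → Query k n → Secret k n → PK k n → Fin n → Bits (msgLen k)

attribute [instance] OTProtocol.finInit OTProtocol.finQuery OTProtocol.finRes
  OTProtocol.repPK OTProtocol.repQuery OTProtocol.repSecret OTProtocol.repRes

namespace OTProtocol

variable {msgLen : ℕ → ℕ} (P : OTProtocol msgLen)

/-- The bit length of the response. -/
def resSize (k n : ℕ) : ℕ := bitLength (P.Res k n)

/-- All coins of an execution: of initialization, query generation and response generation. -/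
abbrev Coins (k n : ℕ) : Type :=
  (P.InitCoins k n → Bool) × (P.QueryCoins k n → Bool) × (P.ResCoins k n → Bool)

/-- What the sender sees: its input, its coins (two strings), and the query received. -/
abbrev SenderView (k n : ℕ) : Type :=
  (Fin n → Bits (msgLen k)) × (P.InitCoins k n → Bool) × (P.ResCoins k n → Bool) × P.Query k n

/-- What the receiver sees: its input, its coins, and the public key and response received. -/
abbrev ReceiverView (k n : ℕ) : Type :=
  Fin n × (P.QueryCoins k n → Bool) × P.PK k n × P.Res k n

section Run

variable (k n : ℕ) (m : Fin n → Bits (msgLen k)) (s : Fin n) (r : P.Coins k n)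

/-- The public key in the execution with coins `r`. -/
def runPK : P.PK k n := P.init k n r.1

/-- The query and the secret parameter in the execution. -/
def runQuery : P.Query k n × P.Secret k n := P.genQuery k n (P.runPK k n r) s r.2.1

/-- The response in the execution. -/
def runRes : P.Res k n := P.genRes k n m (P.runPK k n r) (P.runQuery k n s r).1 r.2.2

/-- The output of the receiver in the execution. -/
def runOutput : Bits (msgLen k) :=
  P.retrieve k n (P.runRes k n m s r) (P.runQuery k n s r).1 (P.runQuery k n s r).2
    (P.runPK k n r) s

/-- The view of the sender in the execution. -/
def senderView : P.SenderView k n := (m, r.1, r.2.2, (P.runQuery k n s r).1)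

/-- The view of the receiver in the execution. -/
def receiverView : P.ReceiverView k n := (s, r.2.1, P.runPK k n r, P.runRes k n m s r)

end Run

variable (n : ℕ → ℕ)

/-- The four algorithms run in polynomial time when there are `n k` messages. -/
def Efficient : Prop :=
  PolyTime (fun k (r : P.InitCoins k (n k) → Bool) => P.init k (n k) r) ∧
  PolyTime (fun k (x : P.PK k (n k) × Fin (n k) × (P.QueryCoins k (n k) → Bool)) =>
    P.genQuery k (n k) x.1 x.2.1 x.2.2) ∧
  PolyTime (fun k (x : (Fin (n k) → Bits (msgLen k)) × P.PK k (n k) × P.Query k (n k) ×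
    (P.ResCoins k (n k) → Bool)) => P.genRes k (n k) x.1 x.2.1 x.2.2.1 x.2.2.2) ∧
  PolyTime (fun k (x : P.Res k (n k) × P.Query k (n k) × P.Secret k (n k) × P.PK k (n k) ×
    Fin (n k)) => P.retrieve k (n k) x.1 x.2.1 x.2.2.1 x.2.2.2.1 x.2.2.2.2)

/-- The receiver's output is the one prescribed by the functionality, except with negligible
probability. -/
def Correct : Prop :=
  ∃ μ : ℕ → ℝ, Negligible μ ∧ ∀ k (m : Fin (n k) → Bits (msgLen k)) (s : Fin (n k)),
    prob (fun r : P.Coins k (n k) => P.runOutput k (n k) m s r ≠ (fOT m s).2) ≤ μ k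

/-- The view of a semi-honest sender can be simulated, in non-uniform probabilistic polynomial
time, from its input and output. -/
def SenderSimulatable : Prop :=
  ∃ (c : ℕ → Type) (_ : ∀ k, Fintype (c k))
    (Sim : ∀ k, (Fin (n k) → Bits (msgLen k)) × Unit × (c k → Bool) → P.SenderView k (n k)),
    PolyTime Sim ∧
    CompIndist
      (fun k (i : (Fin (n k) → Bits (msgLen k)) × Fin (n k)) (ρ : c k → Bool) =>
        Sim k (i.1, (fOT i.1 i.2).1, ρ))
      (fun k (i : (Fin (n k) → Bits (msgLen k)) × Fin (n k)) (r : P.Coins k (n k)) =>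
        P.senderView k (n k) i.1 i.2 r)

/-- The view of a semi-honest receiver can be simulated, in non-uniform probabilistic polynomial
time, from its input and output. -/
def ReceiverSimulatable : Prop :=
  ∃ (c : ℕ → Type) (_ : ∀ k, Fintype (c k))
    (Sim : ∀ k, Fin (n k) × Bits (msgLen k) × (c k → Bool) → P.ReceiverView k (n k)),
    PolyTime Sim ∧
    CompIndist
      (fun k (i : (Fin (n k) → Bits (msgLen k)) × Fin (n k)) (ρ : c k → Bool) =>
        Sim k (i.2, (fOT i.1 i.2).2, ρ))
      (fun k (i : (Fin (n k) → Bits (msgLen k)) × Fin (n k)) (r : P.Coins k (n k)) =>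
        P.receiverView k (n k) i.1 i.2 r)

/-- The protocol, with `n k` messages at security parameter `k`, securely computes the 1-out-of-`n`
oblivious transfer functionality in the presence of (non-colluding) semi-honest adversaries. -/
def SecurelyComputesOT : Prop :=
  P.Efficient n ∧ P.Correct n ∧ P.SenderSimulatable n ∧ P.ReceiverSimulatable n

end OTProtocol

/-! ### Conventional 1-out-of-`n` oblivious transfer -/

/-- Conventional 1-out-of-`n` oblivious transfers. The response is a vector `(e₀, …, eₙ₋₁)`, where
`eᵢ` consists of `w k` values of `ℓ k` bits, and the receiver retrieves `mₛ` from the component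
`eₛ`. -/
structure OTScheme (ℓ : ℕ → ℕ) where
  msgLen : ℕ → ℕ
  pkLen : ℕ → ℕ
  w : ℕ → ℕ
  initCoins : ℕ → ℕ
  queryLen : ℕ → ℕ → ℕ
  secretLen : ℕ → ℕ → ℕ
  queryCoins : ℕ → ℕ → ℕ
  resCoins : ℕ → ℕ → ℕ
  init : ∀ k, Bits (initCoins k) → Bits (pkLen k)
  genQuery : ∀ k n, Bits (pkLen k) → Fin n → Bits (queryCoins k n) →
    Bits (queryLen k n) × Bits (secretLen k n)
  genRes : ∀ k n, (Fin n → Bits (msgLen k)) → Bits (pkLen k) → Bits (queryLen k n) →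
    Bits (resCoins k n) → Fin n → Fin (w k) → Bits (ℓ k)
  retrieve : ∀ k n, (Fin (w k) → Bits (ℓ k)) → Bits (queryLen k n) → Bits (secretLen k n) →
    Bits (pkLen k) → Fin n → Bits (msgLen k)

/-- The protocol given by a conventional oblivious transfer: all of `(e₀, …, eₙ₋₁)` is sent. -/
def OTScheme.toProtocol {ℓ : ℕ → ℕ} (O : OTScheme ℓ) : OTProtocol O.msgLen where
  InitCoins k _ := Fin (O.initCoins k)
  QueryCoins k n := Fin (O.queryCoins k n)
  ResCoins k n := Fin (O.resCoins k n)
  finInit _ _ := inferInstance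
  finQuery _ _ := inferInstance
  finRes _ _ := inferInstance
  PK k _ := Bits (O.pkLen k)
  Query k n := Bits (O.queryLen k n)
  Secret k n := Bits (O.secretLen k n)
  Res k n := Fin n → Fin (O.w k) → Bits (ℓ k)
  repPK _ _ := inferInstance
  repQuery _ _ := inferInstance
  repSecret _ _ := inferInstance
  repRes _ _ := inferInstance
  init k _ r := O.init k r
  genQuery k n pk s r := O.genQuery k n pk s r
  genRes k n m pk q r := O.genRes k n m pk q r
  retrieve k n res q sp pk s := O.retrieve k n (res s) q sp pk s

/-! ### Additively homomorphic encryption -/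

/-- The algorithms of an additively homomorphic public-key encryption scheme whose plaintexts are
strings of `ℓ k` bits. To a key pair `(sk, pk)` belongs a commutative ring `R k sk pk`, in which a
plaintext `x` stands for the element `val k sk pk x` (in Paillier's scheme, `x` is the binary
notation of an integer taken modulo the public modulus); `zero` and `one` are plaintexts that stand
for `0` and `1`. The operations `hadd` and `hmul` are the homomorphic addition and
the homomorphic multiplication by a plaintext. -/
structure AHE (ℓ : ℕ → ℕ) where
  skLen : ℕ → ℕ
  pkLen : ℕ → ℕ
  ctLen : ℕ → ℕ
  keyCoins : ℕ → ℕ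
  encCoins : ℕ → ℕ
  R : ∀ k, Bits (skLen k) → Bits (pkLen k) → Type
  ringR : ∀ k sk pk, CommRing (R k sk pk)
  val : ∀ k sk pk, Bits (ℓ k) → R k sk pk
  zero : ∀ k, Bits (ℓ k)
  one : ∀ k, Bits (ℓ k)
  keyGen : ∀ k, Bits (keyCoins k) → Bits (skLen k) × Bits (pkLen k)
  enc : ∀ k, Bits (pkLen k) → Bits (ℓ k) → Bits (encCoins k) → Bits (ctLen k)
  dec : ∀ k, Bits (skLen k) → Bits (ctLen k) → Bits (ℓ k)
  hadd : ∀ k, Bits (pkLen k) → Bits (ctLen k) → Bits (ctLen k) → Bits (ctLen k)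
  hmul : ∀ k, Bits (pkLen k) → Bits (ctLen k) → Bits (ℓ k) → Bits (ctLen k)

attribute [instance] AHE.ringR

namespace AHE

variable {ℓ : ℕ → ℕ} (E : AHE ℓ)

/-- `E.IsEnc k sk pk c x`: the ciphertext `c` is an encryption of `x`, that is, it arises from
encryptions of plaintexts by homomorphic operations whose effect on the ring elements gives `x`. -/
inductive IsEnc (k : ℕ) (sk : Bits (E.skLen k)) (pk : Bits (E.pkLen k)) :
    Bits (E.ctLen k) → E.R k sk pk → Prop
  | enc (x : Bits (ℓ k)) (r : Bits (E.encCoins k)) :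
      IsEnc k sk pk (E.enc k pk x r) (E.val k sk pk x)
  | hadd {c d : Bits (E.ctLen k)} {x y : E.R k sk pk} :
      IsEnc k sk pk c x → IsEnc k sk pk d y → IsEnc k sk pk (E.hadd k pk c d) (x + y)
  | hmul {c : Bits (E.ctLen k)} {x : E.R k sk pk} (a : Bits (ℓ k)) :
      IsEnc k sk pk c x → IsEnc k sk pk (E.hmul k pk c a) (x * E.val k sk pk a)

/-- Correctness of decryption, for all ciphertexts obtained by encryption and homomorphic operations,
whenever the encrypted ring element is (represented by) a plaintext. -/
def IsHomomorphic : Prop :=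
  ∀ k (g : Bits (E.keyCoins k)) (sk : Bits (E.skLen k)) (pk : Bits (E.pkLen k)),
    E.keyGen k g = (sk, pk) →
      E.val k sk pk (E.zero k) = 0 ∧ E.val k sk pk (E.one k) = 1 ∧
      ∀ (c : Bits (E.ctLen k)) (x : Bits (ℓ k)),
        E.IsEnc k sk pk c (E.val k sk pk x) → E.dec k sk c = x

/-- All algorithms run in polynomial time. -/
def Efficient : Prop :=
  PolyTime (fun k (g : Bits (E.keyCoins k)) => E.keyGen k g) ∧
  PolyTime (fun k (x : Bits (E.pkLen k) × Bits (ℓ k) × Bits (E.encCoins k)) =>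
    E.enc k x.1 x.2.1 x.2.2) ∧
  PolyTime (fun k (x : Bits (E.skLen k) × Bits (E.ctLen k)) => E.dec k x.1 x.2) ∧
  PolyTime (fun k (x : Bits (E.pkLen k) × Bits (E.ctLen k) × Bits (E.ctLen k)) =>
    E.hadd k x.1 x.2.1 x.2.2) ∧
  PolyTime (fun k (x : Bits (E.pkLen k) × Bits (E.ctLen k) × Bits (ℓ k)) =>
    E.hmul k x.1 x.2.1 x.2.2)

/-- The probability that the adversary `(A₁, A₂)`, with coins indexed by `c k`, answers `true` in the
chosen-plaintext experiment in which plaintext number `b` is encrypted: `A₁` chooses two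
plaintexts after seeing the public key, and `A₂` sees the public key, the coins of `A₁` (hence all
that `A₁` computed), and the challenge ciphertext. -/
noncomputable def cpaProb (c : ℕ → Type)
    (A₁ : ∀ k, Bits (E.pkLen k) × (c k → Bool) → Bits (ℓ k) × Bits (ℓ k))
    (A₂ : ∀ k, Bits (E.pkLen k) × (c k → Bool) × Bits (E.ctLen k) → Bool)
    (b : Bool) (k : ℕ) : ℝ :=
  prob (fun ω : Bits (E.keyCoins k) × (c k → Bool) × Bits (E.encCoins k) =>
    let pk := (E.keyGen k ω.1).2
    let x := A₁ k (pk, ω.2.1)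
    A₂ k (pk, ω.2.1, E.enc k pk (if b then x.2 else x.1) ω.2.2) = true)

/-- Indistinguishability under chosen-plaintext attacks of non-uniform probabilistic
polynomial-time adversaries. -/
def INDCPA : Prop :=
  ∀ (c : ℕ → Type) [∀ k, Fintype (c k)]
    (A₁ : ∀ k, Bits (E.pkLen k) × (c k → Bool) → Bits (ℓ k) × Bits (ℓ k))
    (A₂ : ∀ k, Bits (E.pkLen k) × (c k → Bool) × Bits (E.ctLen k) → Bool),
    PolyTime A₁ → PolyTime A₂ →
      Negligible (fun k => |E.cpaProb c A₁ A₂ true k - E.cpaProb c A₁ A₂ false k|)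

/-- The homomorphic sum of the ciphertexts `c 0, …, c (n-1)` (meaningful for `n ≥ 1`). -/
def hsum (k : ℕ) (pk : Bits (E.pkLen k)) {n : ℕ} (c : Fin n → Bits (E.ctLen k)) :
    Bits (E.ctLen k) :=
  match List.ofFn c with
  | [] => fun _ => false
  | d :: ds => ds.foldl (E.hadd k pk) d

end AHE

/-! ### The compiler -/

/-- The oblivious transfer with constant size response. The receiver also creates a key pair of the
encryption scheme and sends the public key and the encryptions of the entries of the indicator
vector of `s`; the sender returns, for each of the `w k` positions `j`, the homomorphic inner
product of these ciphertexts with the `j`-th values of `e₀, …, eₙ₋₁`; the receiver decrypts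
and retrieves the message from the result. -/
def OTScheme.compile {ℓ : ℕ → ℕ} (O : OTScheme ℓ) (E : AHE ℓ) : OTProtocol O.msgLen where
  InitCoins k _ := Fin (O.initCoins k)
  QueryCoins k n := Fin (O.queryCoins k n) ⊕ Fin (E.keyCoins k) ⊕ (Fin n × Fin (E.encCoins k))
  ResCoins k n := Fin (O.resCoins k n)
  finInit _ _ := inferInstance
  finQuery _ _ := inferInstance
  finRes _ _ := inferInstance
  PK k _ := Bits (O.pkLen k)
  Query k n := Bits (E.pkLen k) × Bits (O.queryLen k n) × (Fin n → Bits (E.ctLen k))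
  Secret k n := Bits (O.secretLen k n) × Bits (E.skLen k)
  Res k _ := Fin (O.w k) → Bits (E.ctLen k)
  repPK _ _ := inferInstance
  repQuery _ _ := inferInstance
  repSecret _ _ := inferInstance
  repRes _ _ := inferInstance
  init k _ r := O.init k r
  genQuery k n pk s r :=
    let base := O.genQuery k n pk s (fun i => r (Sum.inl i))
    let keys := E.keyGen k (fun i => r (Sum.inr (Sum.inl i)))
    ((keys.2, base.1, fun i => E.enc k keys.2 (if i = s then E.one k else E.zero k)
        (fun t => r (Sum.inr (Sum.inr (i, t))))),
      (base.2, keys.1))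
  genRes k n m pk q r :=
    let e := O.genRes k n m pk q.2.1 r
    fun j => E.hsum k q.1 (fun i : Fin n => E.hmul k q.1 (q.2.2 i) (e i j))
  retrieve k n res q sp pk s := O.retrieve k n (fun j => E.dec k sp.2 (res j)) q.2.1 sp.1 pk s

end ConstOT

open ConstOT

/-! The encrypted indicator vector lets the sender select `e_s` blindly. For each `j` the
homomorphic inner product encrypts `∑ i, b_i * e_{i,j} = e_{s,j}`, and decryption is exact
(`AHE.dec_hprod`). Hence, for every choice of coins, the output agrees with that of the conventional
protocol (`OTScheme.runOutput_compile`), and the failure probability is unchanged.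

Receiver's view: the keys and ciphertexts come from the receiver's own coins, and the sender adds no
randomness when forming the inner products. The new view is therefore an efficient function of the
conventional view and independent coins. Applying this function to the conventional simulation gives
the simulator (`CompIndist.map`).

Sender's view: the simulator runs the conventional one and appends a fresh public key with
encryptions of zeros. Security of the conventional protocol replaces the simulated part by the real
one; then IND-CPA replaces the zeros by the indicator vector (`AHE.compIndist_indicator`). The two
vectors differ only at position `s`, so one challenge ciphertext suffices and no hybrid over the `n`
positions is needed. Non-uniformity allows the worst input, in particular `s`, to be hardwired for
each `k`.

Efficiency is bookkeeping: `Computes N f` adds up gate counts under composition, pairing, finite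
families and folds, and `polyTime_iff` turns polynomial bounds on lengths and gate counts into
polynomial time. -/

namespace ConstOT

/-! ### Combining circuits -/

namespace Circuit

/-- Renaming the input wires. -/
def rename {κ : Type} : {ι ι' : Type} → (ι → ι') → Circuit κ ι → Circuit κ ι'
  | _, _, f, .out o => .out (f ∘ o)
  | _, _, f, .const b C => .const b (C.rename (Option.map f))
  | _, _, f, .nand i j C => .nand (f i) (f j) (C.rename (Option.map f))

theorem eval_rename {κ ι ι' : Type} (f : ι → ι') (C : Circuit κ ι) (x : ι' → Bool) :
    (C.rename f).eval x = C.eval (x ∘ f) := by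
  induction C generalizing ι' with
  | out o => rfl
  | const b C ih =>
    simp only [rename, eval, ih]
    congr 1
    funext l
    cases l <;> rfl
  | nand i j C ih =>
    simp only [rename, eval, ih]
    congr 1
    funext l
    cases l <;> rfl

theorem size_rename {κ ι ι' : Type} (f : ι → ι') (C : Circuit κ ι) :
    (C.rename f).size = C.size := by
  induction C generalizing ι' with
  | out o => rfl
  | const b C ih => simp only [rename, size, ih]
  | nand i j C ih => simp only [rename, size, ih]

/-- Running a second circuit on the outputs and the inputs of a first one. -/
def bind {κ κ' : Type} : {ι : Type} → Circuit κ ι → Circuit κ' (κ ⊕ ι) → Circuit κ' ι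
  | _, .out o, D => D.rename (Sum.elim o id)
  -- The gate adds a wire to the inputs seen by the rest; `Sum.map id some` makes the second circuit
  -- skip it.
  | _, .const b C, D => .const b (C.bind (D.rename (Sum.map id some)))
  | _, .nand i j C, D => .nand i j (C.bind (D.rename (Sum.map id some)))

theorem eval_bind {κ κ' ι : Type} (C : Circuit κ ι) (D : Circuit κ' (κ ⊕ ι)) (x : ι → Bool) :
    (C.bind D).eval x = D.eval (Sum.elim (C.eval x) x) := by
  induction C with
  | out o =>
    simp only [bind, eval, eval_rename]
    congr 1
    funext l
    cases l <;> rfl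
  | const b C ih =>
    simp only [bind, eval, ih, eval_rename]
    congr 1
    funext l
    cases l <;> rfl
  | nand i j C ih =>
    simp only [bind, eval, ih, eval_rename]
    congr 1
    funext l
    cases l <;> rfl

theorem size_bind {κ κ' ι : Type} (C : Circuit κ ι) (D : Circuit κ' (κ ⊕ ι)) :
    (C.bind D).size = C.size + D.size := by
  induction C with
  | out o => simp only [bind, size, size_rename, zero_add]
  | const b C ih => simp only [bind, size, ih, size_rename]; omega
  | nand i j C ih => simp only [bind, size, ih, size_rename]; omega

end Circuit

/-! ### Functions computed by circuits of a given size -/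

/-- `f` is computed by a circuit with at most `N` gates. -/
def Computes (N : ℕ) {α β : Type} [BitRep α] [BitRep β] (f : α → β) : Prop :=
  ∃ C : Circuit (BitRep.Idx β) (BitRep.Idx α),
    C.size ≤ N ∧ ∀ x, C.eval (BitRep.bits x) = BitRep.bits (f x)

namespace Computes

variable {α β γ : Type} [BitRep α] [BitRep β] [BitRep γ] {M N : ℕ}

theorem mono {f : α → β} (hf : Computes M f) (h : M ≤ N) : Computes N f :=
  let ⟨C, hC, h'⟩ := hf
  ⟨C, hC.trans h, h'⟩

/-- Rewiring the outputs costs nothing. -/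
theorem rewire {f : α → β} {g : α → γ} (hf : Computes N f) (o : BitRep.Idx γ → BitRep.Idx β)
    (h : ∀ x j, BitRep.bits (g x) j = BitRep.bits (f x) (o j)) : Computes N g := by
  obtain ⟨C, hC, h'⟩ := hf
  refine ⟨C.bind (.out (Sum.inl ∘ o)), ?_, fun x => ?_⟩
  · rw [Circuit.size_bind]; exact hC
  · rw [Circuit.eval_bind, h']
    funext j
    exact (h x j).symm

protected theorem id : Computes 0 (fun x : α => x) :=
  ⟨.out id, le_rfl, fun _ => rfl⟩

theorem comp {g : β → γ} {f : α → β} (hg : Computes M g) (hf : Computes N f) :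
    Computes (N + M) (fun x => g (f x)) := by
  obtain ⟨C, hC, h⟩ := hf
  obtain ⟨D, hD, h'⟩ := hg
  refine ⟨C.bind (D.rename Sum.inl), ?_, fun x => ?_⟩
  · rw [Circuit.size_bind, Circuit.size_rename]; omega
  · rw [Circuit.eval_bind, Circuit.eval_rename, ← h', ← h]; rfl

theorem pair {f : α → β} {g : α → γ} (hf : Computes M f) (hg : Computes N g) :
    Computes (M + N) (fun x => (f x, g x)) := by
  obtain ⟨C, hC, h⟩ := hf
  obtain ⟨D, hD, h'⟩ := hg
  refine ⟨C.bind ((D.rename Sum.inr).bind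
    (.out (Sum.elim (fun i => .inr (.inl i)) Sum.inl))), ?_, fun x => ?_⟩
  · simp only [Circuit.size_bind, Circuit.size_rename, Circuit.size]; omega
  · simp only [Circuit.eval_bind, Circuit.eval_rename, Circuit.eval]
    funext j
    rcases j with j | j
    · exact congrFun (h x) j
    · exact congrFun (h' x) j

theorem fst {f : α → β × γ} (hf : Computes N f) : Computes N (fun x => (f x).1) :=
  hf.rewire Sum.inl fun _ _ => rfl

theorem snd {f : α → β × γ} (hf : Computes N f) : Computes N (fun x => (f x).2) :=
  hf.rewire Sum.inr fun _ _ => rfl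

theorem app {ι : Type} [Fintype ι] {f : α → ι → β} (hf : Computes N f) (i : ι) :
    Computes N (fun x => f x i) :=
  hf.rewire (fun j => (i, j)) fun _ _ => rfl

theorem reindex {ι κ : Type} [Fintype ι] [Fintype κ] {f : α → ι → β} (hf : Computes N f)
    (σ : κ → ι) : Computes N (fun x j => f x (σ j)) :=
  hf.rewire (fun j => (σ j.1, j.2)) fun _ _ => rfl

/-- Repeating the same value. -/
theorem replicate {ι : Type} [Fintype ι] {f : α → β} (hf : Computes N f) :
    Computes N (fun x (_ : ι) => f x) :=
  hf.rewire (fun j => j.2) fun _ _ => rfl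

theorem decideEq {n : ℕ} {f : α → Fin n} (hf : Computes N f) (i : Fin n) :
    Computes N (fun x => decide (i = f x)) :=
  hf.rewire (fun _ => i) fun _ _ => rfl

/-- Every function of a single bit is cheap. -/
theorem ofBool (h : Bool → β) : Computes 3 h := by
  -- A function of one bit is constant, the identity or the negation. The wires are, from newest to
  -- oldest, the negated input, `false`, `true` and the input.
  refine ⟨.const true (.const false (.nand (some (some ())) (some (some ())) (.out fun j =>
    if BitRep.bits (h true) j then
      if BitRep.bits (h false) j then some (some none) else some (some (some ()))
    else if BitRep.bits (h false) j then none else some none))), le_rfl, fun x => ?_⟩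
  funext j
  simp only [Circuit.eval]
  cases x <;> cases h1 : BitRep.bits (h true) j <;> cases h2 : BitRep.bits (h false) j <;>
    simp <;> rfl

protected theorem const (b : β) : Computes 2 (fun _ : α => b) := by
  refine ⟨.const true (.const false (.out fun j =>
    if BitRep.bits b j then some none else none)), le_rfl, fun x => ?_⟩
  funext j
  simp only [Circuit.eval]
  cases h1 : BitRep.bits b j <;> simp

/-- Computing finitely many values. -/
theorem pi {ι : Type} [Fintype ι] {f : ι → α → β} (hf : ∀ i, Computes N (f i)) :
    Computes (Fintype.card ι * N + 1) (fun x i => f i x) := by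
  classical
  have key : ∀ l : List ι, ∃ C : Circuit (ι × BitRep.Idx β) (BitRep.Idx α),
      C.size ≤ l.length * N + 1 ∧
        ∀ x, ∀ i ∈ l, ∀ j, C.eval (BitRep.bits x) (i, j) = BitRep.bits (f i x) j := by
    intro l
    induction l with
    -- Every output position has to read some wire, even for indices not yet treated; this constant
    -- accounts for the `+ 1`.
    | nil => exact ⟨.const false (.out fun _ => none), by simp [Circuit.size], by simp⟩
    | cons a l ih =>
      obtain ⟨C, hC, h⟩ := ih
      obtain ⟨D, hD, h'⟩ := hf a
      refine ⟨C.bind ((D.rename Sum.inr).bind (.out fun p =>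
        if p.1 = a then .inl p.2 else .inr (.inl p))), ?_, fun x i hi j => ?_⟩
      · simp only [Circuit.size_bind, Circuit.size_rename, Circuit.size, List.length_cons,
          add_mul, one_mul]
        omega
      · simp only [Circuit.eval_bind, Circuit.eval_rename, Circuit.eval]
        by_cases hia : i = a
        · subst hia
          simp only [if_true, Sum.elim_inl]
          exact congrFun (h' x) j
        · simp only [hia, if_false, Sum.elim_inr, Sum.elim_inl]
          exact h x i ((List.mem_cons.1 hi).resolve_left hia) j
  obtain ⟨C, hC, h⟩ := key Finset.univ.toList
  refine ⟨C, by simpa using hC, fun x => ?_⟩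
  funext ⟨i, j⟩
  exact h x i (by simp) j

/-- Folding a binary operation over a list of values. -/
theorem foldl {g : γ × β × β → β} (hg : Computes M g) {z : α → γ} (hz : Computes 0 z)
    (l : List (α → β)) (hl : ∀ f ∈ l, Computes N f) {K : ℕ} {f : α → β} (hf : Computes K f) :
    Computes (K + l.length * (N + M))
      (fun x => (l.map (fun f => f x)).foldl (fun a b => g (z x, a, b)) (f x)) := by
  induction l generalizing K f with
  | nil => simpa using hf
  | cons a l ih =>
    -- The parameter `z` is fed to every step anew, which is free because it costs no gates.
    have h1 := hg.comp (hz.pair (hf.pair (hl a (by simp))))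
    refine (ih (fun f hf => hl f (by simp [hf])) h1).mono ?_
    simp only [List.length_cons, add_mul, one_mul]
    omega

end Computes

/-! ### Polynomial bounds and polynomial time -/

namespace PolyBounded

theorem mono {f g : ℕ → ℕ} (hg : PolyBounded g) (h : ∀ k, f k ≤ g k) : PolyBounded f :=
  let ⟨p, hp⟩ := hg
  ⟨p, fun k => (h k).trans (hp k)⟩

protected theorem const (c : ℕ) : PolyBounded (fun _ => c) :=
  ⟨Polynomial.C c, fun k => by simp⟩

protected theorem add {f g : ℕ → ℕ} (hf : PolyBounded f) (hg : PolyBounded g) :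
    PolyBounded (fun k => f k + g k) := by
  obtain ⟨p, hp⟩ := hf
  obtain ⟨q, hq⟩ := hg
  exact ⟨p + q, fun k => by simpa using add_le_add (hp k) (hq k)⟩

protected theorem mul {f g : ℕ → ℕ} (hf : PolyBounded f) (hg : PolyBounded g) :
    PolyBounded (fun k => f k * g k) := by
  obtain ⟨p, hp⟩ := hf
  obtain ⟨q, hq⟩ := hg
  exact ⟨p * q, fun k => by simpa using Nat.mul_le_mul (hp k) (hq k)⟩

end PolyBounded

@[simp] theorem bitLength_prod (α β : Type) [BitRep α] [BitRep β] :
    bitLength (α × β) = bitLength α + bitLength β :=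
  Fintype.card_sum

@[simp] theorem bitLength_pi (ι α : Type) [Fintype ι] [BitRep α] :
    bitLength (ι → α) = Fintype.card ι * bitLength α :=
  Fintype.card_prod _ _

@[simp] theorem bitLength_bool : bitLength Bool = 1 := rfl

@[simp] theorem bitLength_fin (n : ℕ) : bitLength (Fin n) = n :=
  Fintype.card_fin n

/-- Separating lengths from gate counts lets each be bounded by its own arithmetic; the three
polynomials are added up in the end. -/
theorem polyTime_iff {α β : ℕ → Type} [∀ k, BitRep (α k)] [∀ k, BitRep (β k)]
    (F : ∀ k, α k → β k) :
    PolyTime F ↔ PolyBounded (fun k => bitLength (α k)) ∧ PolyBounded (fun k => bitLength (β k)) ∧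
      ∃ N, PolyBounded N ∧ ∀ k, Computes (N k) (F k) := by
  constructor
  · rintro ⟨p, hp⟩
    choose C hC h using hp
    refine ⟨⟨p, fun k => ?_⟩, ⟨p, fun k => ?_⟩, fun k => p.eval k, ⟨p, fun k => le_rfl⟩,
      fun k => ⟨C k, ?_, h k⟩⟩
    all_goals have := hC k; dsimp only; omega
  · rintro ⟨⟨p, hp⟩, ⟨q, hq⟩, N, ⟨r, hr⟩, h⟩
    refine ⟨p + q + r, fun k => ?_⟩
    obtain ⟨C, hC, h'⟩ := h k
    refine ⟨C, ?_, h'⟩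
    have h1 := hp k
    have h2 := hq k
    have h3 := hr k
    dsimp only at h1 h2
    simp only [Polynomial.eval_add]
    omega

/-! ### Probabilities -/

theorem prob_equiv {Ω Ω' : Type} (e : Ω ≃ Ω') {A : Ω → Prop} {B : Ω' → Prop}
    (h : ∀ ω, A ω ↔ B (e ω)) : prob A = prob B := by
  unfold prob
  rw [Nat.card_congr e, Nat.card_congr (e.subtypeEquiv h)]

theorem prob_fst {Ω Ω' : Type} [Finite Ω'] [Nonempty Ω'] (A : Ω → Prop) :
    prob (fun ω : Ω × Ω' => A ω.1) = prob A := by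
  unfold prob
  have e : {ω : Ω × Ω' // A ω.1} ≃ {ω : Ω // A ω} × Ω' := Equiv.prodSubtypeFstEquivSubtypeProd
  rw [Nat.card_congr e, Nat.card_prod, Nat.card_prod, Nat.cast_mul, Nat.cast_mul]
  exact mul_div_mul_right _ _ (Nat.cast_ne_zero.2 Nat.card_pos.ne')

/-- Splitting a string of coins. -/
def coinsSum (X Y : Type) : (X ⊕ Y → Bool) ≃ (X → Bool) × (Y → Bool) :=
  Equiv.sumArrowEquivProdArrow X Y Bool

/-! ### Negligible functions and computational indistinguishability -/

namespace CompIndist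

variable {I Ω Ω' Ω'' V W : ℕ → Type} [∀ k, BitRep (V k)] [∀ k, BitRep (W k)]

theorem trans {X : ∀ k, I k → Ω k → V k} {Y : ∀ k, I k → Ω' k → V k}
    {Z : ∀ k, I k → Ω'' k → V k} (h : CompIndist X Y) (h' : CompIndist Y Z) :
    CompIndist X Z := by
  intro c _ D hD
  obtain ⟨μ, hμ, h1⟩ := h c D hD
  obtain ⟨ν, hν, h2⟩ := h' c D hD
  exact ⟨μ + ν, hμ.add hν, fun k i =>
    (abs_sub_le _ _ _).trans (add_le_add (h1 k i) (h2 k i))⟩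

/-- Ensembles may be sampled from other coins. -/
theorem congr {Ω₁ Ω₂ : ℕ → Type} {X : ∀ k, I k → Ω k → V k} {Y : ∀ k, I k → Ω' k → V k}
    {X' : ∀ k, I k → Ω₁ k → V k} {Y' : ∀ k, I k → Ω₂ k → V k} (h : CompIndist X Y)
    (e : ∀ k, Ω₁ k ≃ Ω k) (e' : ∀ k, Ω₂ k ≃ Ω' k) (hX : ∀ k i ω, X' k i ω = X k i (e k ω))
    (hY : ∀ k i ω, Y' k i ω = Y k i (e' k ω)) : CompIndist X' Y' := by
  intro c _ D hD
  obtain ⟨μ, hμ, h1⟩ := h c D hD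
  refine ⟨μ, hμ, fun k i => ?_⟩
  rw [prob_equiv ((e k).prodCongr (Equiv.refl (c k → Bool)))
      (B := fun ω => D k (X k i ω.1, ω.2) = true) (fun ω => by rw [hX]; rfl),
    prob_equiv ((e' k).prodCongr (Equiv.refl (c k → Bool)))
      (B := fun ω => D k (Y k i ω.1, ω.2) = true) (fun ω => by rw [hY]; rfl)]
  exact h1 k i

/-- Probabilistic polynomial-time postprocessing preserves indistinguishability. -/
theorem map {X : ∀ k, I k → Ω k → V k} {Y : ∀ k, I k → Ω' k → V k} (h : CompIndist X Y)
    (d : ℕ → Type) [∀ k, Fintype (d k)] {F : ∀ k, V k × (d k → Bool) → W k} (hF : PolyTime F) :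
    CompIndist (fun k i (ω : Ω k × (d k → Bool)) => F k (X k i ω.1, ω.2))
      (fun k i (ω : Ω' k × (d k → Bool)) => F k (Y k i ω.1, ω.2)) := by
  intro c _ D hD
  have hD' : PolyTime (fun k (x : V k × (d k ⊕ c k → Bool)) =>
      D k (F k (x.1, fun i => x.2 (Sum.inl i)), fun i => x.2 (Sum.inr i))) := by
    rw [polyTime_iff] at *
    obtain ⟨hF1, hF2, N, hN, hF3⟩ := hF
    obtain ⟨hD1, hD2, M, hM, hD3⟩ := hD
    refine ⟨(hF1.add hD1).mono fun k => ?_, hD2, fun k => (N k + 0) + M k,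
      (hN.add (PolyBounded.const 0)).add hM, fun k => ?_⟩
    · simp only [bitLength_prod, bitLength_pi, Fintype.card_sum, bitLength_bool]
      omega
    · have h1 : Computes 0 (fun x : V k × (d k ⊕ c k → Bool) => x) := Computes.id
      exact (hD3 k).comp ((((hF3 k).comp (h1.fst.pair (h1.snd.reindex Sum.inl))).pair
        (h1.snd.reindex Sum.inr)).mono (by omega))
  obtain ⟨μ, hμ, h1⟩ := h _ _ hD'
  refine ⟨μ, hμ, fun k i => ?_⟩
  have key : ∀ (Ω : Type) (Z : Ω → V k),
      prob (fun ω : (Ω × (d k → Bool)) × (c k → Bool) =>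
        D k (F k (Z ω.1.1, ω.1.2), ω.2) = true) =
      prob (fun ω : Ω × (d k ⊕ c k → Bool) =>
        D k (F k (Z ω.1, fun i => ω.2 (Sum.inl i)), fun i => ω.2 (Sum.inr i)) = true) :=
    fun Ω Z => prob_equiv ((Equiv.prodAssoc _ _ _).trans
      ((Equiv.refl Ω).prodCongr (coinsSum _ _).symm)) fun ω => Iff.rfl
  rw [key, key]
  exact h1 k i

end CompIndist

/-- Indistinguishability, uniform over the inputs, follows from negligible advantage for every choice
of one input for each value of the security parameter. -/
theorem compIndist_of_forall_choice {I Ω Ω' V : ℕ → Type} [∀ k, BitRep (V k)]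
    [∀ k, Finite (I k)] [∀ k, Nonempty (I k)]
    {X : ∀ k, I k → Ω k → V k} {Y : ∀ k, I k → Ω' k → V k}
    (h : ∀ (c : ℕ → Type) [∀ k, Fintype (c k)] (D : ∀ k, V k × (c k → Bool) → Bool),
      PolyTime D → ∀ i : ∀ k, I k, Negligible (fun k =>
        |prob (fun ω : Ω k × (c k → Bool) => D k (X k (i k) ω.1, ω.2) = true) -
          prob (fun ω : Ω' k × (c k → Bool) => D k (Y k (i k) ω.1, ω.2) = true)|)) :
    CompIndist X Y := by
  intro c _ D hD
  -- The inputs for each `k` are finite in number, so some input maximizes the advantage; the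
  -- advantage at this worst choice is the uniform bound.
  choose i hi using fun k => Finite.exists_max (fun i : I k =>
    |prob (fun ω : Ω k × (c k → Bool) => D k (X k i ω.1, ω.2) = true) -
      prob (fun ω : Ω' k × (c k → Bool) => D k (Y k i ω.1, ω.2) = true)|)
  exact ⟨_, h c D hD i, hi⟩

/-! ### Encrypting an indicator vector -/

namespace AHE

variable {ℓ : ℕ → ℕ} (E : AHE ℓ)

/-- The coins for a key pair and `n` encryptions. -/
abbrev KeyEncCoins (k n : ℕ) : Type := Fin (E.keyCoins k) ⊕ (Fin n × Fin (E.encCoins k))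

/-- A key pair from the coins `y`. -/
def keysOf {k n : ℕ} (y : E.KeyEncCoins k n → Bool) : Bits (E.skLen k) × Bits (E.pkLen k) :=
  E.keyGen k (fun i => y (Sum.inl i))

/-- The encryptions of `x 0, …, x (n-1)` with the public key and the coins from `y`. -/
def encsOf {k n : ℕ} (x : Fin n → Bits (ℓ k)) (y : E.KeyEncCoins k n → Bool) (i : Fin n) :
    Bits (E.ctLen k) :=
  E.enc k (E.keysOf y).2 (x i) (fun t => y (Sum.inr (i, t)))

/-- The vector with a single entry `one`. -/
def indicator (k : ℕ) {n : ℕ} (s i : Fin n) : Bits (ℓ k) := if i = s then E.one k else E.zero k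

/-- The sample space of the chosen-plaintext experiment for position `s`, with the coins for
position `s` exchanged with those of the challenge. -/
def challengeEquiv (W c : Type) {k n : ℕ} (s : Fin n) :
    (((W → Bool) × (E.KeyEncCoins k n → Bool)) × (c → Bool)) × Bits (E.encCoins k) ≃
      Bits (E.keyCoins k) × (W ⊕ (Fin n × Fin (E.encCoins k)) ⊕ c → Bool) ×
        Bits (E.encCoins k) where
  -- The coins of position `s` become those of the challenge, and the spare string `ω.2` fills the
  -- gap they leave.
  toFun ω := (fun i => ω.1.1.2 (.inl i),
    Sum.elim ω.1.1.1 (Sum.elim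
      (fun p => if p.1 = s then ω.2 p.2 else ω.1.1.2 (.inr p)) ω.1.2),
    fun t => ω.1.1.2 (.inr (s, t)))
  invFun ω := (((fun i => ω.2.1 (.inl i), Sum.elim ω.1
    (fun p => if p.1 = s then ω.2.2 p.2 else ω.2.1 (.inr (.inl p)))),
      fun i => ω.2.1 (.inr (.inr i))), fun t => ω.2.1 (.inr (.inl (s, t))))
  left_inv := by
    rintro ⟨⟨⟨a, b⟩, c⟩, d⟩
    simp only [Sum.elim_inl, Sum.elim_inr, Prod.mk.injEq, if_true, true_and, and_true]
    funext i
    rcases i with i | ⟨i, t⟩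
    · rfl
    · by_cases h : i = s
      · simp [h]
      · simp [h]
  right_inv := by
    rintro ⟨a, b, c⟩
    simp only [Sum.elim_inl, Sum.elim_inr, Prod.mk.injEq, if_true, true_and, and_true]
    funext i
    rcases i with i | ⟨i, t⟩ | i
    · rfl
    · by_cases h : i = s
      · simp [h]
      · simp [h]
    · rfl

/-- Encryptions of zeros, except for the challenge ciphertext at position `s`. -/
def planted {W c : Type} {k n : ℕ} (s : Fin n) (x : Bits (E.pkLen k) ×
    (W ⊕ (Fin n × Fin (E.encCoins k)) ⊕ c → Bool) × Bits (E.ctLen k)) (j : Fin n) :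
    Bits (E.ctLen k) :=
  if j = s then x.2.2 else E.enc k x.1 (E.zero k) (fun t => x.2.1 (.inr (.inl (j, t))))

theorem computes_planted {W c : Type} [Fintype W] [Fintype c] {k n N : ℕ} (s : Fin n)
    (hE : Computes N (fun x : Bits (E.pkLen k) × Bits (ℓ k) × Bits (E.encCoins k) =>
      E.enc k x.1 x.2.1 x.2.2)) :
    Computes (n * (2 + N) + 1) (E.planted (W := W) (c := c) (k := k) s) := by
  have h1 : Computes 0 (fun x : Bits (E.pkLen k) ×
    (W ⊕ (Fin n × Fin (E.encCoins k)) ⊕ c → Bool) × Bits (E.ctLen k) => x) := Computes.id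
  have := Computes.pi (ι := Fin n) (N := 2 + N)
    (f := fun j x => E.planted (W := W) (c := c) (k := k) s x j) fun j => by
      -- As `s` is fixed, this distinction is made while the circuit is built and costs no gates.
      by_cases hj : j = s
      · simp only [planted, hj, if_true]
        exact h1.snd.snd.mono (Nat.zero_le _)
      · simp only [planted, hj, if_false]
        exact (hE.comp (h1.fst.pair ((Computes.const (E.zero k)).pair
          (h1.snd.fst.reindex fun t => .inr (.inl (j, t)))))).mono (by omega)
  rwa [Fintype.card_fin] at this

/-- Away from `s` both vectors consist of zeros, so the bit `b` influences only the planted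
ciphertext. This is why a single challenge is enough. -/
theorem encsOf_eq_planted {W c : Type} {k n : ℕ} (s : Fin n) (b : Bool)
    (ω : (((W → Bool) × (E.KeyEncCoins k n → Bool)) × (c → Bool)) × Bits (E.encCoins k)) :
    E.encsOf (if b then E.indicator k s else fun _ => E.zero k) ω.1.1.2 =
      E.planted s ((E.keysOf ω.1.1.2).2, (E.challengeEquiv W c s ω).2.1,
        E.enc k (E.keysOf ω.1.1.2).2 (if b then E.one k else E.zero k)
          (E.challengeEquiv W c s ω).2.2) := by
  funext j
  by_cases hj : j = s
  · subst hj
    cases b <;> simp [encsOf, indicator, planted, challengeEquiv]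
  · cases b <;> simp [encsOf, indicator, planted, challengeEquiv, hj]

/-- The second part of the adversary that distinguishes encryptions of the indicator vector of `s`
from encryptions of zeros by `D`. -/
def guess {V : Type} {W c : Type} {k n : ℕ} (s : Fin n)
    (U : (W → Bool) × Bits (E.pkLen k) × (Fin n → Bits (E.ctLen k)) → V)
    (D : V × (c → Bool) → Bool) (x : Bits (E.pkLen k) ×
    (W ⊕ (Fin n × Fin (E.encCoins k)) ⊕ c → Bool) × Bits (E.ctLen k)) : Bool :=
  D (U (fun w => x.2.1 (.inl w), x.1, E.planted (k := k) s x), fun l => x.2.1 (.inr (.inr l)))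

/-- The reduction is lossless: for each `b` the adversary reproduces exactly the distinguisher's
experiment, so the advantages coincide. -/
theorem cpaProb_guess {n : ℕ → ℕ} {V W c : ℕ → Type} (s : ∀ k, Fin (n k))
    (U : ∀ k, (W k → Bool) × Bits (E.pkLen k) × (Fin (n k) → Bits (E.ctLen k)) → V k)
    (D : ∀ k, V k × (c k → Bool) → Bool) (b : Bool) (k : ℕ) :
    E.cpaProb (fun k => W k ⊕ (Fin (n k) × Fin (E.encCoins k)) ⊕ c k)
      (fun k _ => (E.zero k, E.one k)) (fun k => E.guess (k := k) (s k) (U k) (D k)) b k =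
      prob (fun ω : ((W k → Bool) × (E.KeyEncCoins k (n k) → Bool)) × (c k → Bool) =>
        D k (U k (ω.1.1, (E.keysOf ω.1.2).2, E.encsOf
          (if b then E.indicator k (s k) else fun _ => E.zero k) ω.1.2), ω.2) = true) := by
  -- The adversary also holds encryption coins for position `s`, which it ignores; a spare string is
  -- added to match them.
  rw [← prob_fst (Ω' := Bits (E.encCoins k))]
  refine (prob_equiv (E.challengeEquiv (W k) (c k) (s k)) fun ω => ?_).symm
  rw [encsOf_eq_planted]
  rfl

/-- Encryptions of the indicator vector of `s` are indistinguishable from encryptions of zeros. -/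
theorem compIndist_indicator {E : AHE ℓ} (hEff : E.Efficient) (hCPA : E.INDCPA)
    {n : ℕ → ℕ} (hn : PolyBounded n) {I V : ℕ → Type} [∀ k, Finite (I k)] [∀ k, Nonempty (I k)]
    [∀ k, BitRep (V k)] (s : ∀ k, I k → Fin (n k)) (W : ℕ → Type) [∀ k, Fintype (W k)]
    (U : ∀ k, I k → (W k → Bool) × Bits (E.pkLen k) × (Fin (n k) → Bits (E.ctLen k)) → V k)
    (hU : ∀ i : ∀ k, I k, PolyTime (fun k x => U k (i k) x)) :
    CompIndist
      (fun k i (ω : (W k → Bool) × (E.KeyEncCoins k (n k) → Bool)) =>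
        U k i (ω.1, (E.keysOf ω.2).2, E.encsOf (fun _ => E.zero k) ω.2))
      (fun k i (ω : (W k → Bool) × (E.KeyEncCoins k (n k) → Bool)) =>
        U k i (ω.1, (E.keysOf ω.2).2, E.encsOf (E.indicator k (s k i)) ω.2)) := by
  refine compIndist_of_forall_choice fun c _ D hD i => ?_
  have hU' := hU i
  obtain ⟨-, hEnc, -⟩ := hEff
  rw [polyTime_iff] at hD hU' hEnc
  obtain ⟨hD1, -, ND, hND, hD3⟩ := hD
  obtain ⟨hU1, -, NU, hNU, hU3⟩ := hU'
  obtain ⟨hE1, hE2, NE, hNE, hE3⟩ := hEnc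
  -- No bound on `W` or `c` is assumed: these coins are read by `U` and `D`, whose input lengths are
  -- polynomially bounded.
  have hlen : PolyBounded (fun k => bitLength (Bits (E.pkLen k) ×
      (W k ⊕ (Fin (n k) × Fin (E.encCoins k)) ⊕ c k → Bool))) := by
    refine ((hU1.add (hn.mul hE1)).add hD1).mono fun k => ?_
    simp only [bitLength_prod, bitLength_pi, Fintype.card_sum, Fintype.card_prod, Fintype.card_fin,
      bitLength_bool, mul_one, mul_add]
    omega
  have hA₁ : PolyTime (fun k (_ : Bits (E.pkLen k) ×
      (W k ⊕ (Fin (n k) × Fin (E.encCoins k)) ⊕ c k → Bool)) => (E.zero k, E.one k)) := by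
    rw [polyTime_iff]
    refine ⟨hlen, (hE1.add hE1).mono fun k => ?_, _, PolyBounded.const 2,
      fun k => Computes.const _⟩
    simp only [bitLength_prod]
    omega
  have hA₂ : PolyTime (fun k => E.guess (k := k) (s k (i k)) (U k (i k)) (D k)) := by
    rw [polyTime_iff]
    refine ⟨(hlen.add hE2).mono fun k => ?_, PolyBounded.const 1, fun k =>
      (n k * (2 + NE k) + 1) + NU k + ND k,
      (((hn.mul ((PolyBounded.const 2).add hNE)).add (PolyBounded.const 1)).add hNU).add hND,
      fun k => ?_⟩
    · simp only [bitLength_prod]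
      omega
    · have h1 : Computes 0 (fun x : Bits (E.pkLen k) ×
        (W k ⊕ (Fin (n k) × Fin (E.encCoins k)) ⊕ c k → Bool) × Bits (E.ctLen k) => x) :=
        Computes.id
      have h2 := E.computes_planted (W := W k) (c := c k) (k := k) (s k (i k)) (hE3 k)
      exact ((hD3 k).comp (((hU3 k).comp ((h1.snd.fst.reindex Sum.inl).pair
        (h1.fst.pair h2))).pair (h1.snd.fst.reindex fun l => .inr (.inr l)))).mono
          (by dsimp only; omega)
  have h := hCPA (fun k => W k ⊕ (Fin (n k) × Fin (E.encCoins k)) ⊕ c k)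
    (fun k _ => (E.zero k, E.one k)) (fun k => E.guess (k := k) (s k (i k)) (U k (i k)) (D k))
    hA₁ hA₂
  have e := E.cpaProb_guess (fun k => s k (i k)) (fun k => U k (i k)) D
  refine (congrArg Negligible (funext fun k => ?_)).mp h
  -- The zeros come first here, whereas the chosen-plaintext advantage starts with `true`, the bit
  -- for which `one` is encrypted.
  rw [abs_sub_comm, e, e]
  rfl

end AHE

/-! ### Circuits for the parts of the compiled protocol -/

theorem Computes.sumElim {α β ι κ : Type} [BitRep α] [BitRep β] [Fintype ι] [Fintype κ] {M N : ℕ}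
    {f : α → ι → β} {g : α → κ → β} (hf : Computes M f) (hg : Computes N g) :
    Computes (M + N) (fun x => Sum.elim (f x) (g x)) :=
  (hf.pair hg).rewire
    (fun j => Sum.elim (fun i => .inl (i, j.2)) (fun i => .inr (i, j.2)) j.1)
    (by rintro x ⟨i | i, j⟩ <;> rfl)

/-- Postprocessing an algorithm with further coins. -/
theorem polyTime_postprocess {A B V W c d : ℕ → Type} [∀ k, BitRep (A k)] [∀ k, BitRep (B k)]
    [∀ k, BitRep (V k)] [∀ k, BitRep (W k)] [∀ k, Fintype (c k)] [∀ k, Fintype (d k)]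
    {Sim : ∀ k, A k × B k × (c k → Bool) → V k} (hSim : PolyTime Sim)
    {F : ∀ k, V k × (d k → Bool) → W k} (hF : PolyTime F) :
    PolyTime (fun k (x : A k × B k × (c k ⊕ d k → Bool)) =>
      F k (Sim k (x.1, x.2.1, fun i => x.2.2 (.inl i)), fun i => x.2.2 (.inr i))) := by
  rw [polyTime_iff] at *
  obtain ⟨h1, -, N, hN, h2⟩ := hSim
  obtain ⟨h3, h4, M, hM, h5⟩ := hF
  refine ⟨(h1.add h3).mono fun k => ?_, h4, _, hN.add hM, fun k => ?_⟩
  · simp only [bitLength_prod, bitLength_pi, Fintype.card_sum, bitLength_bool]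
    omega
  · have h : Computes 0 (fun x : A k × B k × (c k ⊕ d k → Bool) => x) := Computes.id
    exact ((h5 k).comp (((h2 k).comp (h.fst.pair (h.snd.fst.pair (h.snd.snd.reindex Sum.inl)))).pair
      (h.snd.snd.reindex Sum.inr))).mono (by omega)

namespace AHE

variable {ℓ : ℕ → ℕ} (E : AHE ℓ)

theorem computes_encsOf {α : Type} [BitRep α] {k n K M N : ℕ}
    (hK : Computes K (E.keyGen k))
    (hE : Computes N (fun x : Bits (E.pkLen k) × Bits (ℓ k) × Bits (E.encCoins k) =>
      E.enc k x.1 x.2.1 x.2.2))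
    {x : α → Fin n → Bits (ℓ k)} (hx : ∀ i, Computes M (fun a => x a i))
    {y : α → E.KeyEncCoins k n → Bool} (hy : Computes 0 y) :
    Computes (n * (K + M + N) + 1) (fun a => E.encsOf (x a) (y a)) := by
  -- The key pair is recomputed from its coins for each ciphertext, hence the factor `n` at `K`.
  have h := Computes.pi (N := K + M + N) (f := fun i a => E.encsOf (x a) (y a) i) fun i =>
    (hE.comp ((hK.comp (hy.reindex Sum.inl)).snd.pair
      ((hx i).pair (hy.reindex fun t => Sum.inr (i, t))))).mono (by omega)
  rwa [Fintype.card_fin] at h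

/-- Indices are represented by indicator strings, so the test `i = s` is already a wire; three gates
turn it into a plaintext. -/
theorem computes_indicator {α : Type} [BitRep α] (k : ℕ) {n : ℕ} {s : α → Fin n}
    (hs : Computes 0 s) (i : Fin n) : Computes 3 (fun a => E.indicator k (s a) i) := by
  have h := (Computes.ofBool fun b => if b then E.one k else E.zero k).comp (hs.decideEq i)
  simpa only [indicator, decide_eq_true_eq, zero_add] using h

theorem computes_hsum {α : Type} [BitRep α] {k n M N : ℕ}
    (hA : Computes M (fun x : Bits (E.pkLen k) × Bits (E.ctLen k) × Bits (E.ctLen k) =>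
      E.hadd k x.1 x.2.1 x.2.2))
    {pk : α → Bits (E.pkLen k)} (hpk : Computes 0 pk)
    {c : α → Fin n → Bits (E.ctLen k)} (hc : ∀ i, Computes N (fun a => c a i)) :
    Computes (n * (N + M) + 2) (fun a => E.hsum k (pk a) (c a)) := by
  cases n with
  -- The empty sum is the all-`false` string by convention; its two gates explain the `+ 2`.
  | zero => exact (Computes.const (fun _ => false)).mono (by omega)
  | succ n =>
    have h := Computes.foldl hA hpk (List.ofFn fun i a => c a (Fin.succ i))
      (fun f hf => by
        obtain ⟨i, rfl⟩ := List.mem_ofFn.1 hf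
        exact hc _) (hc 0)
    have e : (fun a => E.hsum k (pk a) (c a)) = fun a =>
        ((List.ofFn fun i a => c a (Fin.succ i)).map fun f => f a).foldl
          (fun x y => E.hadd k (pk a) x y) (c a 0) := by
      funext a
      simp only [hsum, List.ofFn_succ, List.map_ofFn]
      rfl
    rw [e]
    refine h.mono ?_
    simp only [List.length_ofFn, add_mul, one_mul]
    omega

/-- The homomorphic inner products of a vector of ciphertexts with the columns of a matrix of
plaintexts. -/
def hprod (k : ℕ) {n w : ℕ} (pk : Bits (E.pkLen k)) (b : Fin n → Bits (E.ctLen k))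
    (e : Fin n → Fin w → Bits (ℓ k)) (j : Fin w) : Bits (E.ctLen k) :=
  E.hsum k pk (fun i => E.hmul k pk (b i) (e i j))

theorem computes_hprod {k n w A H : ℕ}
    (hA : Computes A (fun x : Bits (E.pkLen k) × Bits (E.ctLen k) × Bits (E.ctLen k) =>
      E.hadd k x.1 x.2.1 x.2.2))
    (hH : Computes H (fun x : Bits (E.pkLen k) × Bits (E.ctLen k) × Bits (ℓ k) =>
      E.hmul k x.1 x.2.1 x.2.2)) :
    Computes (w * (n * (H + A) + 2) + 1)
      (fun x : Bits (E.pkLen k) × (Fin n → Bits (E.ctLen k)) × (Fin n → Fin w → Bits (ℓ k)) =>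
        E.hprod k x.1 x.2.1 x.2.2) := by
  have h1 : Computes 0 (fun x : Bits (E.pkLen k) × (Fin n → Bits (E.ctLen k)) ×
    (Fin n → Fin w → Bits (ℓ k)) => x) := Computes.id
  have h := Computes.pi (ι := Fin w) fun j => E.computes_hsum hA h1.fst fun i =>
    (hH.comp (h1.fst.pair ((h1.snd.fst.app i).pair ((h1.snd.snd.app i).app j)))).mono
      (N := H) (by omega)
  rwa [Fintype.card_fin] at h

/-! ### Correctness of the homomorphic inner product -/

/-- Each ciphertext is paired with its ring element, so that one induction follows both
accumulators. -/
theorem isEnc_foldl {k : ℕ} {sk : Bits (E.skLen k)} {pk : Bits (E.pkLen k)}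
    (l : List (Bits (E.ctLen k) × E.R k sk pk)) (hl : ∀ p ∈ l, E.IsEnc k sk pk p.1 p.2)
    {c : Bits (E.ctLen k)} {x : E.R k sk pk} (hc : E.IsEnc k sk pk c x) :
    E.IsEnc k sk pk ((l.map Prod.fst).foldl (E.hadd k pk) c) (x + (l.map Prod.snd).sum) := by
  induction l generalizing c x with
  | nil => simpa using hc
  | cons p l ih =>
    have h := ih (fun q hq => hl q (by simp [hq])) (hc.hadd (hl p (by simp)))
    simpa only [List.map_cons, List.foldl_cons, List.sum_cons, add_assoc] using h

/-- For `n = 0` the default string need not encrypt anything, hence `1 ≤ n`. -/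
theorem isEnc_hsum {k n : ℕ} {sk : Bits (E.skLen k)} {pk : Bits (E.pkLen k)} (hn : 1 ≤ n)
    {c : Fin n → Bits (E.ctLen k)} {x : Fin n → E.R k sk pk}
    (h : ∀ i, E.IsEnc k sk pk (c i) (x i)) : E.IsEnc k sk pk (E.hsum k pk c) (∑ i, x i) := by
  obtain ⟨n, rfl⟩ := Nat.exists_eq_add_of_le' hn
  have := E.isEnc_foldl (List.ofFn fun i : Fin n => (c i.succ, x i.succ))
    (fun p hp => by
      obtain ⟨i, rfl⟩ := List.mem_ofFn.1 hp
      exact h _) (h 0)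
  simp only [List.map_ofFn, List.sum_ofFn] at this
  rw [Fin.sum_univ_succ]
  simp only [hsum, List.ofFn_succ]
  exact this

/-- The terms of the inner product are added in the ring, where all but the one at `s` vanish. Only
the total has to be represented by a plaintext, and it is represented by `e s j`; so decryption
returns precisely this bit string. -/
theorem dec_hprod {E : AHE ℓ} (hHom : E.IsHomomorphic) {k n w : ℕ} (hn : 1 ≤ n) (s : Fin n)
    (y : E.KeyEncCoins k n → Bool) (e : Fin n → Fin w → Bits (ℓ k)) (j : Fin w) :
    E.dec k (E.keysOf y).1
      (E.hprod k (E.keysOf y).2 (E.encsOf (E.indicator k s) y) e j) = e s j := by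
  obtain ⟨h0, h1, hdec⟩ := hHom k (fun i => y (.inl i)) (E.keysOf y).1 (E.keysOf y).2 rfl
  apply hdec
  have h := E.isEnc_hsum hn fun i => (IsEnc.enc (E := E) (sk := (E.keysOf y).1)
    (pk := (E.keysOf y).2) (E.indicator k s i) (fun t => y (.inr (i, t)))).hmul (e i j)
  have hs : ∑ i, E.val k (E.keysOf y).1 (E.keysOf y).2 (E.indicator k s i) *
      E.val k (E.keysOf y).1 (E.keysOf y).2 (e i j) =
        E.val k (E.keysOf y).1 (E.keysOf y).2 (e s j) := by
    rw [Finset.sum_eq_single s]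
    · simp only [indicator, if_true, h1, one_mul]
    · intro i _ hi
      simp only [indicator, hi, if_false, h0, zero_mul]
    · simp
  rw [← hs]
  exact h

end AHE

/-- Splitting off a part of the second of three strings of coins. -/
def splitCoins (A X Y B : Type) :
    A × (X ⊕ Y → Bool) × B ≃ (A × (X → Bool) × B) × (Y → Bool) where
  toFun r := ((r.1, fun i => r.2.1 (.inl i), r.2.2), fun i => r.2.1 (.inr i))
  invFun r := (r.1.1, Sum.elim r.1.2.1 r.2, r.1.2.2)
  left_inv := by
    rintro ⟨a, b, c⟩
    simp only [Prod.mk.injEq, true_and, and_true]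
    funext i
    cases i <;> rfl
  right_inv _ := rfl

/-- Three strings of coins as a single one. -/
def joinCoins (X Y Z : Type) :
    (X ⊕ Y ⊕ Z → Bool) ≃ (X → Bool) × (Y → Bool) × (Z → Bool) :=
  (coinsSum X (Y ⊕ Z)).trans ((Equiv.refl _).prodCongr (coinsSum Y Z))

/-! ### Efficiency and correctness of the compiled protocol -/

namespace OTScheme

variable {ℓ : ℕ → ℕ} (O : OTScheme ℓ) (E : AHE ℓ)

/-- Unfolding the protocol exposes the concrete string types, on which the length formulas can act.
-/
theorem efficient_toProtocol_iff (n : ℕ → ℕ) : O.toProtocol.Efficient n ↔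
    PolyTime (fun k (r : Bits (O.initCoins k)) => O.init k r) ∧
    PolyTime (fun k (x : Bits (O.pkLen k) × Fin (n k) × Bits (O.queryCoins k (n k))) =>
      O.genQuery k (n k) x.1 x.2.1 x.2.2) ∧
    PolyTime (fun k (x : (Fin (n k) → Bits (O.msgLen k)) × Bits (O.pkLen k) ×
      Bits (O.queryLen k (n k)) × Bits (O.resCoins k (n k))) =>
      O.genRes k (n k) x.1 x.2.1 x.2.2.1 x.2.2.2) ∧
    PolyTime (fun k (x : (Fin (n k) → Fin (O.w k) → Bits (ℓ k)) × Bits (O.queryLen k (n k)) ×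
      Bits (O.secretLen k (n k)) × Bits (O.pkLen k) × Fin (n k)) =>
      O.retrieve k (n k) (x.1 x.2.2.2.2) x.2.1 x.2.2.1 x.2.2.2.1 x.2.2.2.2) :=
  Iff.rfl

variable {O E} {n : ℕ → ℕ}

/-- The lengths in a scheme are arbitrary functions; they are bounded because they occur in the
inputs or outputs of efficient algorithms. -/
theorem polyBounded_lengths (hℓ : ∀ k, 1 ≤ ℓ k) (hn1 : ∀ k, 1 ≤ n k)
    (hO : O.toProtocol.Efficient n) :
    PolyBounded O.initCoins ∧ PolyBounded O.pkLen ∧ PolyBounded (fun k => O.queryCoins k (n k)) ∧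
    PolyBounded (fun k => O.queryLen k (n k)) ∧ PolyBounded (fun k => O.secretLen k (n k)) ∧
    PolyBounded O.msgLen ∧ PolyBounded (fun k => O.resCoins k (n k)) ∧ PolyBounded O.w := by
  rw [efficient_toProtocol_iff] at hO
  obtain ⟨h1, h2, h3, h4⟩ := hO
  rw [polyTime_iff] at h1 h2 h3 h4
  obtain ⟨a1, b1, -⟩ := h1
  obtain ⟨a2, b2, -⟩ := h2
  obtain ⟨a3, b3, -⟩ := h3
  obtain ⟨a4, b4, -⟩ := h4
  simp only [bitLength_prod, bitLength_pi, Fintype.card_fin, bitLength_bool, mul_one,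
    bitLength_fin] at a1 b1 a2 b2 a3 b3 a4 b4
  refine ⟨a1, b1, a2.mono fun k => ?_, b2.mono fun k => ?_, b2.mono fun k => ?_, b4,
    a3.mono fun k => ?_, b3.mono fun k => ?_⟩
  -- Only the product `n * (w * ℓ)` is known to be bounded; `w` is below it because `n` and `ℓ` are
  -- at least `1`.
  on_goal 5 => exact (Nat.le_mul_of_pos_right _ (hℓ k)).trans (Nat.le_mul_of_pos_left _ (hn1 k))
  all_goals omega

theorem efficient_compile (hℓ : ∀ k, 1 ≤ ℓ k) (hE : E.Efficient) (hn1 : ∀ k, 1 ≤ n k)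
    (hn : PolyBounded n) (hO : O.toProtocol.Efficient n) : (O.compile E).Efficient n := by
  obtain ⟨bi, bp, bqc, bq, bs, bm, bc, bw⟩ := polyBounded_lengths hℓ hn1 hO
  rw [efficient_toProtocol_iff] at hO
  obtain ⟨h1, h2, h3, h4⟩ := hO
  obtain ⟨e1, e2, e3, e4, e5⟩ := hE
  rw [polyTime_iff] at h2 h3 h4 e1 e2 e3 e4 e5
  obtain ⟨-, -, N2, hN2, h2⟩ := h2
  obtain ⟨-, -, N3, hN3, h3⟩ := h3
  obtain ⟨-, -, N4, hN4, h4⟩ := h4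
  obtain ⟨ak, bk, K, hK, e1⟩ := e1
  obtain ⟨ae, be, N, hN, e2⟩ := e2
  obtain ⟨-, -, D, hD, e3⟩ := e3
  obtain ⟨-, -, A, hA, e4⟩ := e4
  obtain ⟨-, -, H, hH, e5⟩ := e5
  have c1 := PolyBounded.const 1
  have c2 := PolyBounded.const 2
  have c3 := PolyBounded.const 3
  refine ⟨h1, ?_, ?_, ?_⟩
  · change PolyTime (fun k (x : Bits (O.pkLen k) × Fin (n k) × (Fin (O.queryCoins k (n k)) ⊕
      E.KeyEncCoins k (n k) → Bool)) =>
      (((E.keysOf fun i => x.2.2 (.inr i)).2,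
        (O.genQuery k (n k) x.1 x.2.1 fun i => x.2.2 (.inl i)).1,
        E.encsOf (E.indicator k x.2.1) fun i => x.2.2 (.inr i)),
      ((O.genQuery k (n k) x.1 x.2.1 fun i => x.2.2 (.inl i)).2,
        (E.keysOf fun i => x.2.2 (.inr i)).1)))
    rw [polyTime_iff]
    refine ⟨(((bp.add hn).add bqc).add (ak.add (hn.mul ae))).mono fun k => ?_,
      ((bk.add (bq.add bs)).add (hn.mul be)).mono fun k => ?_,
      fun k => (K k + (N2 k + (n k * (K k + 3 + N k) + 1))) + (N2 k + K k),
      (hK.add (hN2.add ((hn.mul ((hK.add c3).add hN)).add c1))).add (hN2.add hK), fun k => ?_⟩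
    · simp only [bitLength_prod, bitLength_pi, Fintype.card_sum, Fintype.card_prod,
        Fintype.card_fin, bitLength_bool, mul_one, mul_add, bitLength_fin]
      omega
    · simp only [bitLength_prod, bitLength_pi, Fintype.card_fin, bitLength_bool, mul_one]
      omega
    · have h : Computes 0 (fun x : Bits (O.pkLen k) × Fin (n k) × (Fin (O.queryCoins k (n k)) ⊕
        E.KeyEncCoins k (n k) → Bool) => x) := Computes.id
      have hk := (e1 k).comp ((h.snd.snd.reindex Sum.inr).reindex Sum.inl)
      have hq := (h2 k).comp (h.fst.pair (h.snd.fst.pair (h.snd.snd.reindex Sum.inl)))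
      have he := E.computes_encsOf (e1 k) (e2 k) (E.computes_indicator k h.snd.fst)
        (h.snd.snd.reindex Sum.inr)
      exact ((hk.snd.pair (hq.fst.pair he)).pair (hq.snd.pair hk.fst)).mono (by dsimp only; omega)
  · change PolyTime (fun k (x : (Fin (n k) → Bits (O.msgLen k)) × Bits (O.pkLen k) ×
      (Bits (E.pkLen k) × Bits (O.queryLen k (n k)) × (Fin (n k) → Bits (E.ctLen k))) ×
      Bits (O.resCoins k (n k))) =>
      E.hprod k x.2.2.1.1 x.2.2.1.2.2 (O.genRes k (n k) x.1 x.2.1 x.2.2.1.2.1 x.2.2.2))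
    rw [polyTime_iff]
    refine ⟨((((hn.mul bm).add bp).add (bk.add (bq.add (hn.mul be)))).add bc).mono fun k => ?_,
      (bw.mul be).mono fun k => ?_,
      fun k => N3 k + (O.w k * (n k * (H k + A k) + 2) + 1),
      hN3.add ((bw.mul ((hn.mul (hH.add hA)).add c2)).add c1), fun k => ?_⟩
    · simp only [bitLength_prod, bitLength_pi, Fintype.card_fin, bitLength_bool, mul_one]
      omega
    · simp only [bitLength_pi, Fintype.card_fin, bitLength_bool, mul_one, le_refl]
    · have h : Computes 0 (fun x : (Fin (n k) → Bits (O.msgLen k)) × Bits (O.pkLen k) ×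
        (Bits (E.pkLen k) × Bits (O.queryLen k (n k)) × (Fin (n k) → Bits (E.ctLen k))) ×
        Bits (O.resCoins k (n k)) => x) := Computes.id
      have hr := (h3 k).comp (h.fst.pair (h.snd.fst.pair (h.snd.snd.fst.snd.fst.pair h.snd.snd.snd)))
      exact ((E.computes_hprod (e4 k) (e5 k)).comp (h.snd.snd.fst.fst.pair
        (h.snd.snd.fst.snd.snd.pair hr))).mono (by dsimp only; omega)
  · change PolyTime (fun k (x : (Fin (O.w k) → Bits (E.ctLen k)) × (Bits (E.pkLen k) ×
      Bits (O.queryLen k (n k)) × (Fin (n k) → Bits (E.ctLen k))) ×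
      (Bits (O.secretLen k (n k)) × Bits (E.skLen k)) × Bits (O.pkLen k) × Fin (n k)) =>
      O.retrieve k (n k) (fun j => E.dec k x.2.2.1.2 (x.1 j)) x.2.1.2.1 x.2.2.1.1 x.2.2.2.1
        x.2.2.2.2)
    rw [polyTime_iff]
    refine ⟨((((bw.mul be).add (bk.add (bq.add (hn.mul be)))).add (bs.add bk)).add
      (bp.add hn)).mono fun k => ?_, bm.mono fun k => ?_,
      fun k => (O.w k * D k + 1) + N4 k, ((bw.mul hD).add c1).add hN4, fun k => ?_⟩
    · simp only [bitLength_prod, bitLength_pi, Fintype.card_fin, bitLength_bool, mul_one,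
        bitLength_fin]
      omega
    · simp only [bitLength_pi, Fintype.card_fin, bitLength_bool, mul_one, le_refl]
    · have h : Computes 0 (fun x : (Fin (O.w k) → Bits (E.ctLen k)) × (Bits (E.pkLen k) ×
        Bits (O.queryLen k (n k)) × (Fin (n k) → Bits (E.ctLen k))) ×
        (Bits (O.secretLen k (n k)) × Bits (E.skLen k)) × Bits (O.pkLen k) × Fin (n k) => x) :=
        Computes.id
      have hd := Computes.pi (ι := Fin (O.w k)) fun j =>
        (e3 k).comp (h.snd.snd.fst.snd.pair (h.fst.app j))
      rw [Fintype.card_fin] at hd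
      -- The conventional retrieval circuit expects all `n` rows. The decrypted row is copied into
      -- each of them, which needs only wires, and the row at `s` is then the right one.
      exact ((h4 k).comp ((hd.replicate (ι := Fin (n k))).pair (h.snd.fst.snd.fst.pair
        (h.snd.snd.fst.fst.pair h.snd.snd.snd)))).mono (by simp only [zero_add]; omega)

/-- The coins of the compiled protocol are those of the conventional one and those for the
encryption scheme. -/
def compileCoins (O : OTScheme ℓ) (E : AHE ℓ) (k n : ℕ) :
    (O.compile E).Coins k n ≃ O.toProtocol.Coins k n × (E.KeyEncCoins k n → Bool) :=
  splitCoins _ _ _ _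

/-- Decryption never errs, so the equality holds for all coins and no new failure event arises. -/
theorem runOutput_compile (hHom : E.IsHomomorphic) {k n : ℕ} (hn : 1 ≤ n)
    (m : Fin n → Bits (O.msgLen k)) (s : Fin n) (r : (O.compile E).Coins k n) :
    (O.compile E).runOutput k n m s r =
      O.toProtocol.runOutput k n m s (compileCoins O E k n r).1 := by
  have h : ∀ e : Fin n → Fin (O.w k) → Bits (ℓ k), (fun j =>
      E.dec k (E.keysOf (compileCoins O E k n r).2).1
        (E.hprod k (E.keysOf (compileCoins O E k n r).2).2
          (E.encsOf (E.indicator k s) (compileCoins O E k n r).2) e j)) = e s :=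
    fun e => funext fun j => AHE.dec_hprod hHom hn s _ e j
  exact congrArg (fun e => O.retrieve k n e _ _ _ s) (h _)

theorem correct_compile (hHom : E.IsHomomorphic) (hn1 : ∀ k, 1 ≤ n k)
    (hO : O.toProtocol.Correct n) : (O.compile E).Correct n := by
  obtain ⟨μ, hμ, h⟩ := hO
  refine ⟨μ, hμ, fun k m s => ?_⟩
  have e := prob_equiv (compileCoins O E k (n k))
    (A := fun r => (O.compile E).runOutput k (n k) m s r ≠ (fOT m s).2)
    (B := fun ω => O.toProtocol.runOutput k (n k) m s ω.1 ≠ (fOT m s).2)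
    fun r => by rw [runOutput_compile hHom (hn1 k)]
  have e' := prob_fst (Ω' := E.KeyEncCoins k (n k) → Bool)
    (fun r => O.toProtocol.runOutput k (n k) m s r ≠ (fOT m s).2)
  exact (e.trans e').le.trans (h k m s)

/-! ### Simulation -/

/-- The view of the sender of the compiled protocol, when the plaintexts `x` are encrypted. -/
def extendSenderView (O : OTScheme ℓ) (E : AHE ℓ) (k n : ℕ) (x : Fin n → Bits (ℓ k))
    (v : O.toProtocol.SenderView k n × (E.KeyEncCoins k n → Bool)) :
    (O.compile E).SenderView k n :=
  (v.1.1, v.1.2.1, v.1.2.2.1, ((E.keysOf v.2).2, v.1.2.2.2, E.encsOf x v.2))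

/-- The view of the receiver of the compiled protocol. -/
def extendReceiverView (O : OTScheme ℓ) (E : AHE ℓ) (k n : ℕ)
    (v : O.toProtocol.ReceiverView k n × (E.KeyEncCoins k n → Bool)) :
    (O.compile E).ReceiverView k n :=
  (v.1.1, Sum.elim v.1.2.1 v.2, v.1.2.2.1,
    E.hprod k (E.keysOf v.2).2 (E.encsOf (E.indicator k v.1.1) v.2) v.1.2.2.2)

theorem senderView_compile {k n : ℕ} (m : Fin n → Bits (O.msgLen k)) (s : Fin n)
    (r : (O.compile E).Coins k n) : (O.compile E).senderView k n m s r =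
      extendSenderView O E k n (E.indicator k s)
        (O.toProtocol.senderView k n m s (compileCoins O E k n r).1,
          (compileCoins O E k n r).2) :=
  rfl

/-- The inner products involve only the conventional response and the receiver's own ciphertexts, so
nothing else about the sender enters the view. -/
theorem receiverView_compile {k n : ℕ} (m : Fin n → Bits (O.msgLen k)) (s : Fin n)
    (r : (O.compile E).Coins k n) : (O.compile E).receiverView k n m s r =
      extendReceiverView O E k n
        (O.toProtocol.receiverView k n m s (compileCoins O E k n r).1,
          (compileCoins O E k n r).2) := by
  -- Rejoining the split query coins gives back the same string, but not by mere unfolding.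
  have h : Sum.elim (fun i => r.2.1 (.inl i)) (fun i => r.2.1 (.inr i)) = r.2.1 := by
    funext i
    cases i <;> rfl
  exact congrArg (fun c : (O.compile E).QueryCoins k n → Bool => ((s, c, (O.compile E).runPK k n r,
    (O.compile E).runRes k n m s r) : (O.compile E).ReceiverView k n)) h.symm

theorem polyTime_extendSenderView (hℓ : ∀ k, 1 ≤ ℓ k) (hE : E.Efficient) (hn1 : ∀ k, 1 ≤ n k)
    (hn : PolyBounded n) (hO : O.toProtocol.Efficient n) :
    PolyTime (fun k => extendSenderView O E k (n k) fun _ => E.zero k) := by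
  obtain ⟨bi, bp, bqc, bq, bs, bm, bc, bw⟩ := polyBounded_lengths hℓ hn1 hO
  obtain ⟨e1, e2, -⟩ := hE
  rw [polyTime_iff] at e1 e2
  obtain ⟨ak, bk, K, hK, e1⟩ := e1
  obtain ⟨ae, be, N, hN, e2⟩ := e2
  change PolyTime (fun k (v : ((Fin (n k) → Bits (O.msgLen k)) × Bits (O.initCoins k) ×
    Bits (O.resCoins k (n k)) × Bits (O.queryLen k (n k))) × (E.KeyEncCoins k (n k) → Bool)) =>
    (v.1.1, v.1.2.1, v.1.2.2.1, ((E.keysOf v.2).2, v.1.2.2.2, E.encsOf (fun _ => E.zero k) v.2)))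
  rw [polyTime_iff]
  refine ⟨((((hn.mul bm).add bi).add (bc.add bq)).add (ak.add (hn.mul ae))).mono fun k => ?_,
    ((((hn.mul bm).add bi).add (bc.add bq)).add (bk.add (hn.mul be))).mono fun k => ?_,
    fun k => K k + (n k * (K k + 2 + N k) + 1),
    hK.add ((hn.mul ((hK.add (PolyBounded.const 2)).add hN)).add (PolyBounded.const 1)),
    fun k => ?_⟩
  · simp only [bitLength_prod, bitLength_pi, Fintype.card_sum, Fintype.card_prod,
      Fintype.card_fin, bitLength_bool, mul_one, mul_add]
    omega
  · simp only [bitLength_prod, bitLength_pi, Fintype.card_fin, bitLength_bool, mul_one]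
    omega
  · have h : Computes 0 (fun v : ((Fin (n k) → Bits (O.msgLen k)) × Bits (O.initCoins k) ×
      Bits (O.resCoins k (n k)) × Bits (O.queryLen k (n k))) × (E.KeyEncCoins k (n k) → Bool) =>
      v) := Computes.id
    exact (h.fst.fst.pair (h.fst.snd.fst.pair (h.fst.snd.snd.fst.pair
      (((e1 k).comp (h.snd.reindex Sum.inl)).snd.pair (h.fst.snd.snd.snd.pair
        (E.computes_encsOf (e1 k) (e2 k) (fun _ => Computes.const _) h.snd)))))).mono
          (by dsimp only; omega)

theorem polyTime_extendReceiverView (hℓ : ∀ k, 1 ≤ ℓ k) (hE : E.Efficient) (hn1 : ∀ k, 1 ≤ n k)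
    (hn : PolyBounded n) (hO : O.toProtocol.Efficient n) :
    PolyTime (fun k => extendReceiverView O E k (n k)) := by
  obtain ⟨bi, bp, bqc, bq, bs, bm, bc, bw⟩ := polyBounded_lengths hℓ hn1 hO
  obtain ⟨e1, e2, e3, e4, e5⟩ := hE
  rw [polyTime_iff] at e1 e2 e3 e4 e5
  obtain ⟨ak, bk, K, hK, e1⟩ := e1
  obtain ⟨ae, be, N, hN, e2⟩ := e2
  obtain ⟨-, bl, -⟩ := e3
  obtain ⟨-, -, A, hA, e4⟩ := e4
  obtain ⟨-, -, H, hH, e5⟩ := e5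
  change PolyTime (fun k (v : (Fin (n k) × Bits (O.queryCoins k (n k)) × Bits (O.pkLen k) ×
    (Fin (n k) → Fin (O.w k) → Bits (ℓ k))) × (E.KeyEncCoins k (n k) → Bool)) =>
    (v.1.1, (Sum.elim v.1.2.1 v.2 : Fin (O.queryCoins k (n k)) ⊕ E.KeyEncCoins k (n k) → Bool),
      v.1.2.2.1,
      E.hprod k (E.keysOf v.2).2 (E.encsOf (E.indicator k v.1.1) v.2) v.1.2.2.2))
  rw [polyTime_iff]
  refine ⟨(((hn.add bqc).add (bp.add (hn.mul (bw.mul bl)))).add (ak.add (hn.mul ae))).mono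
      fun k => ?_,
    (((hn.add bqc).add (bp.add (bw.mul be))).add (ak.add (hn.mul ae))).mono fun k => ?_,
    fun k => (K k + (n k * (K k + 3 + N k) + 1)) + (O.w k * (n k * (H k + A k) + 2) + 1),
    (hK.add ((hn.mul ((hK.add (PolyBounded.const 3)).add hN)).add (PolyBounded.const 1))).add
      ((bw.mul ((hn.mul (hH.add hA)).add (PolyBounded.const 2))).add (PolyBounded.const 1)),
    fun k => ?_⟩
  · simp only [bitLength_prod, bitLength_pi, Fintype.card_sum, Fintype.card_prod,
      Fintype.card_fin, bitLength_bool, mul_one, mul_add, bitLength_fin]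
    omega
  · simp only [bitLength_prod, bitLength_pi, Fintype.card_sum, Fintype.card_prod,
      Fintype.card_fin, bitLength_bool, mul_one, mul_add, bitLength_fin]
    omega
  · have h : Computes 0 (fun v : (Fin (n k) × Bits (O.queryCoins k (n k)) × Bits (O.pkLen k) ×
      (Fin (n k) → Fin (O.w k) → Bits (ℓ k))) × (E.KeyEncCoins k (n k) → Bool) => v) :=
      Computes.id
    have hk := ((e1 k).comp (h.snd.reindex Sum.inl)).snd
    have he := E.computes_encsOf (e1 k) (e2 k) (E.computes_indicator k h.fst.fst) h.snd
    exact (h.fst.fst.pair ((h.fst.snd.fst.sumElim h.snd).pair (h.fst.snd.snd.fst.pair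
      ((E.computes_hprod (e4 k) (e5 k)).comp (hk.pair (he.pair h.fst.snd.snd.snd)))))).mono
        (by dsimp only; omega)

/-- Secrecy of the encryption plays no role against the holder of the secret key;
indistinguishability is inherited through efficient postprocessing. -/
theorem receiverSimulatable_compile (hℓ : ∀ k, 1 ≤ ℓ k) (hE : E.Efficient) (hn1 : ∀ k, 1 ≤ n k)
    (hn : PolyBounded n) (hO : O.toProtocol.Efficient n)
    (hR : O.toProtocol.ReceiverSimulatable n) : (O.compile E).ReceiverSimulatable n := by
  obtain ⟨c, _, Sim, hSim, hInd⟩ := hR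
  have hF := polyTime_extendReceiverView hℓ hE hn1 hn hO
  refine ⟨fun k => c k ⊕ E.KeyEncCoins k (n k), fun _ => inferInstance, fun k x =>
    extendReceiverView O E k (n k) (Sim k (x.1, x.2.1, fun i => x.2.2 (.inl i)),
      fun i => x.2.2 (.inr i)), polyTime_postprocess hSim hF, ?_⟩
  exact (hInd.map (fun k => E.KeyEncCoins k (n k)) hF).congr (fun _ => coinsSum _ _)
    (fun k => compileCoins O E k (n k)) (fun _ _ _ => rfl)
    (fun _ _ _ => receiverView_compile _ _ _)

/-- The coins of the conventional protocol. -/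
abbrev CoinIdx (O : OTScheme ℓ) (k n : ℕ) : Type :=
  Fin (O.initCoins k) ⊕ Fin (O.queryCoins k n) ⊕ Fin (O.resCoins k n)

/-- The view of the sender of the compiled protocol with input `i`, from the coins of the
conventional protocol, the public key and the ciphertexts. -/
def assembleSenderView (O : OTScheme ℓ) (E : AHE ℓ) (k n : ℕ)
    (i : (Fin n → Bits (O.msgLen k)) × Fin n)
    (x : (O.CoinIdx k n → Bool) × Bits (E.pkLen k) × (Fin n → Bits (E.ctLen k))) :
    (O.compile E).SenderView k n :=
  (i.1, fun j => x.1 (.inl j), fun j => x.1 (.inr (.inr j)),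
    (x.2.1, (O.genQuery k n (O.init k fun j => x.1 (.inl j)) i.2
      fun j => x.1 (.inr (.inl j))).1, x.2.2))

/-- In the reduction to IND-CPA the adversary itself runs the conventional protocol up to the query,
on hardwired messages and index. -/
theorem polyTime_assembleSenderView (hℓ : ∀ k, 1 ≤ ℓ k) (hE : E.Efficient) (hn1 : ∀ k, 1 ≤ n k)
    (hn : PolyBounded n) (hO : O.toProtocol.Efficient n)
    (i : ∀ k, (Fin (n k) → Bits (O.msgLen k)) × Fin (n k)) :
    PolyTime (fun k => assembleSenderView O E k (n k) (i k)) := by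
  obtain ⟨bi, bp, bqc, bq, bs, bm, bc, bw⟩ := polyBounded_lengths hℓ hn1 hO
  rw [efficient_toProtocol_iff] at hO
  obtain ⟨h1, h2, -⟩ := hO
  obtain ⟨e1, e2, -⟩ := hE
  rw [polyTime_iff] at h1 h2 e1 e2
  obtain ⟨-, -, N1, hN1, h1⟩ := h1
  obtain ⟨-, -, N2, hN2, h2⟩ := h2
  obtain ⟨-, bk, -⟩ := e1
  obtain ⟨-, be, -⟩ := e2
  change PolyTime (fun k (x : (O.CoinIdx k (n k) → Bool) × Bits (E.pkLen k) ×
    (Fin (n k) → Bits (E.ctLen k))) =>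
    ((i k).1, (fun j => x.1 (.inl j) : Bits (O.initCoins k)),
      (fun j => x.1 (.inr (.inr j)) : Bits (O.resCoins k (n k))),
      (x.2.1, (O.genQuery k (n k) (O.init k fun j => x.1 (.inl j)) (i k).2
        fun j => x.1 (.inr (.inl j))).1, x.2.2)))
  rw [polyTime_iff]
  refine ⟨((bi.add (bqc.add bc)).add (bk.add (hn.mul be))).mono fun k => ?_,
    ((((hn.mul bm).add bi).add (bc.add bq)).add (bk.add (hn.mul be))).mono fun k => ?_,
    fun k => 2 + ((N1 k + 2) + N2 k),
    (PolyBounded.const 2).add ((hN1.add (PolyBounded.const 2)).add hN2), fun k => ?_⟩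
  · simp only [bitLength_prod, bitLength_pi, Fintype.card_sum, Fintype.card_fin, bitLength_bool,
      mul_one]
    omega
  · simp only [bitLength_prod, bitLength_pi, Fintype.card_fin, bitLength_bool, mul_one]
    omega
  · have h : Computes 0 (fun x : (O.CoinIdx k (n k) → Bool) × Bits (E.pkLen k) ×
      (Fin (n k) → Bits (E.ctLen k)) => x) := Computes.id
    have hq := ((h2 k).comp (((h1 k).comp (h.fst.reindex Sum.inl)).pair
      ((Computes.const (i k).2).pair (h.fst.reindex fun j => .inr (.inl j))))).fst
    exact ((Computes.const (i k).1).pair ((h.fst.reindex Sum.inl).pair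
      ((h.fst.reindex fun j => .inr (.inr j)).pair (h.snd.fst.pair (hq.pair h.snd.snd))))).mono
        (by dsimp only; omega)

theorem senderSimulatable_compile (hℓ : ∀ k, 1 ≤ ℓ k) (hE : E.Efficient) (hCPA : E.INDCPA)
    (hn1 : ∀ k, 1 ≤ n k) (hn : PolyBounded n) (hO : O.toProtocol.Efficient n)
    (hS : O.toProtocol.SenderSimulatable n) : (O.compile E).SenderSimulatable n := by
  obtain ⟨c, _, Sim, hSim, hInd⟩ := hS
  have hF := polyTime_extendSenderView hℓ hE hn1 hn hO
  refine ⟨fun k => c k ⊕ E.KeyEncCoins k (n k), fun _ => inferInstance, fun k x =>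
    extendSenderView O E k (n k) (fun _ => E.zero k)
      (Sim k (x.1, x.2.1, fun i => x.2.2 (.inl i)), fun i => x.2.2 (.inr i)),
    polyTime_postprocess hSim hF, ?_⟩
  have : ∀ k, Nonempty (Fin (n k)) := fun k => ⟨⟨0, hn1 k⟩⟩
  -- Second hop: in the real conventional view, zeros are exchanged for the indicator vector.
  have hI := AHE.compIndist_indicator hE hCPA hn (I := fun k =>
      (Fin (n k) → Bits (O.msgLen k)) × Fin (n k)) (fun _ i => i.2)
    (fun k => O.CoinIdx k (n k)) (fun k => assembleSenderView O E k (n k))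
    (polyTime_assembleSenderView hℓ hE hn1 hn hO)
  -- First hop: the simulated conventional view is exchanged for the real one, with zeros encrypted
  -- throughout. The right-hand side is written with `assembleSenderView` so that it meets `hI`.
  have h1 := (hInd.map (fun k => E.KeyEncCoins k (n k)) hF).congr (fun _ => coinsSum _ _)
    (X' := fun k i ρ => extendSenderView O E k (n k) (fun _ => E.zero k)
      (Sim k (i.1, (fOT i.1 i.2).1, fun i => ρ (.inl i)), fun i => ρ (.inr i)))
    (Y' := fun k i (ω : (O.CoinIdx k (n k) → Bool) × (E.KeyEncCoins k (n k) → Bool)) =>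
      assembleSenderView O E k (n k) i
        (ω.1, (E.keysOf ω.2).2, E.encsOf (fun _ => E.zero k) ω.2))
    (fun k => (joinCoins _ _ _).prodCongr (Equiv.refl _)) (fun _ _ _ => rfl)
    (fun _ _ _ => rfl)
  exact h1.trans (hI.congr (fun _ => Equiv.refl _)
    (fun k => (compileCoins O E k (n k)).trans ((joinCoins _ _ _).symm.prodCongr (Equiv.refl _)))
    (fun _ _ _ => rfl) (fun _ _ _ => senderView_compile _ _ _))

/-! ### Size of the response -/

theorem resSize_compile (O : OTScheme ℓ) (E : AHE ℓ) (k n : ℕ) :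
    (O.compile E).resSize k n = O.w k * E.ctLen k := by
  change bitLength (Fin (O.w k) → Bits (E.ctLen k)) = _
  simp

end OTScheme

end ConstOT

theorem mainTheorem6 (ℓ : ℕ → ℕ) (hℓ : ∀ k, 1 ≤ ℓ k)
    (O : OTScheme ℓ) (E : AHE ℓ)
    (hEff : E.Efficient) (hHom : E.IsHomomorphic) (hCPA : E.INDCPA) :
    (∀ n : ℕ → ℕ, (∀ k, 1 ≤ n k) → PolyBounded n →
      O.toProtocol.SecurelyComputesOT n → (O.compile E).SecurelyComputesOT n) ∧
    (∀ k n, (O.compile E).resSize k n = O.w k * E.ctLen k) ∧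
    (∀ k, (fun n : ℕ => ((O.compile E).resSize k n : ℝ)) =O[Filter.atTop]
      (fun _ : ℕ => (1 : ℝ))) := by
  refine ⟨fun n hn1 hn ⟨h1, h2, h3, h4⟩ =>
    ⟨OTScheme.efficient_compile hℓ hEff hn1 hn h1, OTScheme.correct_compile hHom hn1 h2,
      OTScheme.senderSimulatable_compile hℓ hEff hCPA hn1 hn h1 h3,
      OTScheme.receiverSimulatable_compile hℓ hEff hn1 hn h1 h4⟩,
    OTScheme.resSize_compile O E, fun k => ?_⟩
  simp only [OTScheme.resSize_compile]
  exact Asymptotics.isBigO_const_const _ one_ne_zero _
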